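/- **Theorem.** Let $(G,P)$ be a weak quasi-lattice ordered group: $G$ is a group, $P\subset G$ is a submonoid with $P\cap P^{-1}=\{e\}$, and whenever $p,q\in P$ satisfy $pP\cap qP\neq\emptyset$ there is an element $p\vee q\in P$ with $pP\cap qP=(p\vee q)P$. For a finite set $K\subset P$ write $\Omega_K=\bigcap_{k\in K}(P\setminus kP)$, with $\Omega_\emptyset=P$; let $\vee K\in P$ be the least common right multiple of $K$ if it exists, and put $\vee K=\infty$ otherwise. Let $P_a$ be the set of atoms of $P$, let $\mathcal A_{P_a}$ be the collection of all finite (possibly empty) disjoint unions of sets $p\,\Omega_K$ with $p\in P$ and $K\subset P_a$ finite (possibly empty), and let $\mathcal B_P$ be the algebra of subsets of $P$ generated by the sets $pP$, $p\in P$ (an algebra is a nonempty collection closed under complements and finite unions). Suppose that $\mathcal A_{P_a}$ is an algebra of subsets of $P$. Then: 1. $\mathcal A_{P_a}=\mathcal B_P$. 2. If moreover $P$ is Noetherian (there is no infinite descending sequence with respect to the proper factor relation), then the positivity condition reduces to subsets of atoms. That is, let $A$ be a $C^*$-algebra, let $X=\{X_p\}_{p\in P}$ be a compactly aligned product system over $P$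 of essential $C^*$-correspondences with $X_e=A$, let $N:P\to(0,\infty)$ be a multiplicative homomorphism, let $\beta\in\mathbb R$, and let $\tau$ be a tracial state of $A$. For $p\in P$ and $a\in A_+$ let $$\operatorname{Tr}_\tau^p(a)=\sup_H\sum_{\xi\in H}\tau(\langle\xi,a\xi\rangle)\in[0,\infty],$$ the supremum being over the finite subsets $H\subset X_p$ with $\sum_{\xi\in H}\theta_{\xi,\xi}\le 1$, where $\theta_{\xi,\xi}\eta=\xi\langle\xi,\eta\rangle$. Then the inequality $$\tau(a)+\sum_{\emptyset\ne K\subset J}(-1)^{|K|}N(\vee K)^{-\beta}\operatorname{Tr}_\tau^{\vee K}(a)\ \ge\ 0$$ holds for all $a\in A_+$ and all finite $J\subset P\setminus\{e\}$ if and only if it holds for all $a\in A_+$ and all finite $J\subset P_a$. Here terms with $\vee K=\infty$ are zero, and sums are formed in $[-\infty,\infty]$ with $\infty-\infty=-\infty$. -/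

import Mathlib

open scoped ComplexOrder ENNReal

universe u v w

/-! ### Monoids, least common right multiples and algebras of subsets -/

/-- `(G, P)` is a weak quasi-lattice ordered group: `P` is a submonoid of the group `G` with
`P ∩ P⁻¹ = {e}`, and for `p, q ∈ P` with `pP ∩ qP ≠ ∅` there is `r ∈ P` with `pP ∩ qP = rP`. -/
structure IsWeakQuasiLatticeOrdered {G : Type u} [Group G] (P : Submonoid G) : Prop where
  eq_one_of_inv_mem : ∀ p : G, p ∈ P → p⁻¹ ∈ P → p = 1
  exists_lcm : ∀ p q : P, ({x : P | p ∣ x} ∩ {x : P | q ∣ x}).Nonempty →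
    ∃ r : P, {x : P | p ∣ x} ∩ {x : P | q ∣ x} = {x : P | r ∣ x}

section MonoidDefs

variable {M : Type u} [Monoid M]

/-- The principal right ideal `pM`. -/
def principalRightIdeal (p : M) : Set M := Set.range fun x : M => p * x

/-- `p` is a proper factor of `q`: `q = x p y` where `x` and `y` are not both invertible. -/
def IsProperFactor (p q : M) : Prop :=
  ∃ x y : M, q = x * p * y ∧ (¬ IsUnit x ∨ ¬ IsUnit y)

variable (M) in
/-- `M` is Noetherian: there is no infinite descending sequence for the proper factor relation. -/
def IsNoetherianMonoid : Prop := WellFounded (IsProperFactor (M := M))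

variable (M) in
/-- The set of atoms of `M`: the non-invertible elements all of whose factorisations contain at
most one non-invertible factor. -/
def atoms : Set M := {s | Irreducible s}

/-- `r` is a right LCM of `U` (`a ∣ b` means `b = a * c` for some `c`). -/
def IsRightLCM (U : Set M) (r : M) : Prop :=
  (∀ p ∈ U, p ∣ r) ∧ ∀ r' : M, (∀ p ∈ U, p ∣ r') → r ∣ r'

/-- `Ω_K = ⋂_{k ∈ K} (M \ kM)`, with `Ω_∅ = M`. -/
def Omega (K : Finset M) : Set M := ⋂ k ∈ K, (principalRightIdeal k)ᶜ

/-- The collection `𝒜_R` of all finite (possibly empty) disjoint unions of sets `p Ω_K`, with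
`p ∈ M` and `K` a finite (possibly empty) subset of `R`. -/
def finiteDisjointUnions (R : Set M) : Set (Set M) :=
  {B | ∃ (n : ℕ) (p : Fin n → M) (K : Fin n → Finset M),
    (∀ j, (K j : Set M) ⊆ R) ∧
    Pairwise (fun i j => Disjoint ((fun x => p i * x) '' Omega (K i))
      ((fun x => p j * x) '' Omega (K j))) ∧
    B = ⋃ j, (fun x => p j * x) '' Omega (K j)}

variable (M) in
/-- The algebra `ℬ_M` of subsets of `M` generated by the sets `pM`, `p ∈ M`. -/
def idealAlgebra : Set (Set M) :=
  MeasureTheory.generateSetAlgebra (Set.range (principalRightIdeal (M := M)))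

end MonoidDefs

/-! ### `C*`-correspondences

Mathlib's `CStarModule` has a left action of `A`; the modules below are right Hilbert modules. -/

/-- A `C*`-correspondence over the (not necessarily unital) `C*`-algebra `A`: a right Hilbert
`A`-module, with inner product linear in the second variable, complete in the norm
`‖ξ‖² = ‖⟨ξ, ξ⟩‖`, and with a left action of `A` by a `*`-homomorphism into the adjointable
operators. -/
structure CStarCorrespondence (A : Type v) [NonUnitalCStarAlgebra A] [PartialOrder A]
    [StarOrderedRing A] where
  /-- the underlying space -/
  carrier : Type w
  [normedAddCommGroup : NormedAddCommGroup carrier]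
  [normedSpace : NormedSpace ℂ carrier]
  [completeSpace : CompleteSpace carrier]
  /-- the right action `(ξ, a) ↦ ξ a` -/
  right : carrier →ₗ[ℂ] A →ₗ[ℂ] carrier
  /-- the `A`-valued inner product -/
  inner : carrier → carrier → A
  /-- the left action `(a, ξ) ↦ a ξ` -/
  left : A →ₗ[ℂ] carrier →ₗ[ℂ] carrier
  right_mul : ∀ ξ a b, right ξ (a * b) = right (right ξ a) b
  inner_add : ∀ ξ η ζ, inner ξ (η + ζ) = inner ξ η + inner ξ ζ
  inner_smul : ∀ (c : ℂ) ξ η, inner ξ (c • η) = c • inner ξ η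
  inner_right : ∀ ξ η a, inner ξ (right η a) = inner ξ η * a
  star_inner : ∀ ξ η, star (inner ξ η) = inner η ξ
  inner_self_nonneg : ∀ ξ, 0 ≤ inner ξ ξ
  norm_sq : ∀ ξ, ‖ξ‖ ^ 2 = ‖inner ξ ξ‖
  left_mul : ∀ a b ξ, left (a * b) ξ = left a (left b ξ)
  left_right : ∀ a ξ b, left a (right ξ b) = right (left a ξ) b
  inner_left : ∀ a ξ η, inner (left a ξ) η = inner ξ (left (star a) η)

attribute [instance] CStarCorrespondence.normedAddCommGroup CStarCorrespondence.normedSpace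
  CStarCorrespondence.completeSpace

/-- A tracial state of `A`: a positive linear functional of norm one with `τ(ab) = τ(ba)`. -/
structure TracialState (A : Type v) [NonUnitalCStarAlgebra A] [PartialOrder A] where
  /-- the underlying linear functional -/
  toFun : A →ₗ[ℂ] ℂ
  nonneg : ∀ a, 0 ≤ a → 0 ≤ toFun a
  trace : ∀ a b, toFun (a * b) = toFun (b * a)
  norm_eq_one : IsLUB {r : ℝ | ∃ a, ‖a‖ ≤ 1 ∧ r = ‖toFun a‖} 1

namespace CStarCorrespondence

variable {A : Type v} [NonUnitalCStarAlgebra A] [PartialOrder A] [StarOrderedRing A]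

/-- The generalised compact operators `𝒦(X)`: the norm closure of the linear span of the operators
`θ_{ξ,ζ} : η ↦ ξ ⟨ζ, η⟩`. -/
def compacts (X : CStarCorrespondence.{v, w} A) : Set (X.carrier →L[ℂ] X.carrier) :=
  closure (Submodule.span ℂ {T : X.carrier →L[ℂ] X.carrier |
    ∃ ξ ζ : X.carrier, ∀ η, T η = X.right ξ (X.inner ζ η)} : Set _)

/-- `X` is essential: the span of `A X` is dense in `X`. -/
def IsEssential (X : CStarCorrespondence.{v, w} A) : Prop :=
  Dense (Submodule.span ℂ {η : X.carrier | ∃ a ξ, η = X.left a ξ} : Set X.carrier)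

/-- `∑_{ξ ∈ H} θ_{ξ,ξ} ≤ 1` in the `C*`-algebra of adjointable operators of `X`, expressed by
`⟨η, ∑_{ξ ∈ H} θ_{ξ,ξ} η⟩ ≤ ⟨η, η⟩` for all `η`. -/
def IsSubunital (X : CStarCorrespondence.{v, w} A) (H : Finset X.carrier) : Prop :=
  ∀ η, X.inner η (∑ ξ ∈ H, X.right ξ (X.inner ξ η)) ≤ X.inner η η

/-- The value on `a ∈ A₊`, acting on the left of `X`, of the trace induced by `τ` through `X`:
the supremum of `∑_{ξ ∈ H} τ(⟨ξ, a ξ⟩)` over the finite `H ⊆ X` with `∑_{ξ ∈ H} θ_{ξ,ξ} ≤ 1`. -/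
noncomputable def inducedTrace (X : CStarCorrespondence.{v, w} A) (τ : TracialState A) (a : A) :
    ℝ≥0∞ :=
  ⨆ (H : Finset X.carrier) (_ : X.IsSubunital H),
    ENNReal.ofReal (∑ ξ ∈ H, (τ.toFun (X.inner ξ (X.left a ξ))).re)

end CStarCorrespondence

/-! ### Product systems -/

/-- A product system over the monoid `M` of `C*`-correspondences over `A`. The product of
`ξ ∈ X_p` and `ζ ∈ X_q` lies in `X_r` whenever `p q = r`. That `ξ ⊗ ζ ↦ ξ ζ` induces an isometric
isomorphism of `X_p ⊗_A X_q` onto `X_{pq}` for `p ≠ e` is expressed by the formula for the inner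
product of the interior tensor product together with density of the span of the products. -/
structure ProductSystem (M : Type u) [Monoid M] (A : Type v) [NonUnitalCStarAlgebra A]
    [PartialOrder A] [StarOrderedRing A] where
  /-- the correspondence `X_p` -/
  fiber : M → CStarCorrespondence.{v, w} A
  /-- the multiplication `X_p × X_q → X_{pq}` -/
  mul : ∀ {p q r : M}, p * q = r →
    ((fiber p).carrier →ₗ[ℂ] (fiber q).carrier →ₗ[ℂ] (fiber r).carrier)
  mul_assoc : ∀ {p q r pq qr pqr : M} (h₁ : p * q = pq) (h₂ : pq * r = pqr) (h₃ : q * r = qr)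
    (h₄ : p * qr = pqr) (ξ : (fiber p).carrier) (η : (fiber q).carrier) (ζ : (fiber r).carrier),
    mul h₂ (mul h₁ ξ η) ζ = mul h₄ ξ (mul h₃ η ζ)
  inner_mul : ∀ {p q r : M} (h : p * q = r) (ξ ξ' : (fiber p).carrier)
    (ζ ζ' : (fiber q).carrier),
    (fiber r).inner (mul h ξ ζ) (mul h ξ' ζ') =
      (fiber q).inner ζ ((fiber q).left ((fiber p).inner ξ ξ') ζ')
  dense_mul : ∀ {p q r : M} (h : p * q = r), p ≠ 1 →
    Dense (Submodule.span ℂ {η : (fiber r).carrier | ∃ ξ ζ, η = mul h ξ ζ} :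
      Set (fiber r).carrier)
  /-- the identification of `X_e` with the canonical correspondence `A` over `A` -/
  unit : A ≃ₗ[ℂ] (fiber 1).carrier
  inner_unit : ∀ a b, (fiber 1).inner (unit a) (unit b) = star a * b
  left_unit : ∀ a b, (fiber 1).left a (unit b) = unit (a * b)
  right_unit : ∀ a b, (fiber 1).right (unit a) b = unit (a * b)
  unit_mul : ∀ (p : M) (a : A) (ξ : (fiber p).carrier),
    mul (one_mul p) (unit a) ξ = (fiber p).left a ξ
  mul_unit : ∀ (p : M) (ξ : (fiber p).carrier) (a : A),
    mul (mul_one p) ξ (unit a) = (fiber p).right ξ a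

namespace ProductSystem

variable {M : Type u} [Monoid M] {A : Type v} [NonUnitalCStarAlgebra A] [PartialOrder A]
  [StarOrderedRing A]

/-- All fibres are essential. -/
def IsEssential (X : ProductSystem.{u, v, w} M A) : Prop := ∀ p, (X.fiber p).IsEssential

/-- `T` is the operator `ι_p^r(S)` on `X_r ≅ X_p ⊗_A X_q`, `r = p q`, that corresponds to
`S ⊗ 1`. -/
def IsAmplification (X : ProductSystem.{u, v, w} M A) {p q r : M} (h : p * q = r)
    (S : (X.fiber p).carrier →L[ℂ] (X.fiber p).carrier)
    (T : (X.fiber r).carrier →L[ℂ] (X.fiber r).carrier) : Prop :=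
  ∀ ξ ζ, T (X.mul h ξ ζ) = X.mul h (S ξ) ζ

/-- `X` is compactly aligned: `ι_p^r(𝒦(X_p)) ι_q^r(𝒦(X_q)) ⊆ 𝒦(X_r)` whenever `pM ∩ qM = rM`. -/
def IsCompactlyAligned (X : ProductSystem.{u, v, w} M A) : Prop :=
  ∀ p q r : M,
    principalRightIdeal p ∩ principalRightIdeal q = principalRightIdeal r →
    ∀ (p' q' : M) (hp : p * p' = r) (hq : q * q' = r),
    ∀ S ∈ (X.fiber p).compacts, ∀ T ∈ (X.fiber q).compacts,
    ∀ S' T' : (X.fiber r).carrier →L[ℂ] (X.fiber r).carrier,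
      X.IsAmplification hp S S' → X.IsAmplification hq T T' → S'.comp T' ∈ (X.fiber r).compacts

open Classical in
/-- The summand `(-1)^{|K|} N(∨K)^{-β} Tr_τ^{∨K}(a)`, which is `0` if `∨K = ∞`. -/
noncomputable def positivityTerm (X : ProductSystem.{u, v, w} M A) (N : M →* ℝ) (β : ℝ)
    (τ : TracialState A) (a : A) (K : Finset M) : EReal :=
  if h : ∃ r : M, IsRightLCM (K : Set M) r then
    (((-1) ^ K.card * (N h.choose) ^ (-β) : ℝ) : EReal) *
      (((X.fiber h.choose).inducedTrace τ a : ℝ≥0∞) : EReal)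
  else 0

open Classical in
/-- The positivity condition for the finite subsets `J` of `R`:
`τ(a) + ∑_{∅ ≠ K ⊆ J} (-1)^{|K|} N(∨K)^{-β} Tr_τ^{∨K}(a) ≥ 0` for all `a ∈ A₊`. Induced traces may
be infinite, so the sum is formed in the extended reals, where `∞ - ∞ = -∞`, so that a sum with
opposite infinities violates the condition. -/
def PositivityCondition (X : ProductSystem.{u, v, w} M A) (N : M →* ℝ) (β : ℝ)
    (τ : TracialState A) (R : Set M) : Prop :=
  ∀ J : Finset M, (J : Set M) ⊆ R → ∀ a : A, 0 ≤ a →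
    (0 : EReal) ≤ ((τ.toFun a).re : EReal) +
      ∑ K ∈ J.powerset.filter Finset.Nonempty, X.positivityTerm N β τ a K

end ProductSystem

/-! Part 1 is formal. By left cancellation `p Ω_K` is `pP` minus the finitely many sets `pkP`, so `𝒜
⊆ ℬ`; conversely `𝒜` is an algebra that contains every `pP = p Ω_∅`.

For part 2, let `[p] ↦ 1_{pP}` map formal real combinations of elements of `P` to functions on `P`.
This map is injective, and by inclusion-exclusion it sends `∑_{K ⊆ J} (-1)^{|K|} [∨K]` to the
indicator of `Ω_J` (`indicatorSum_omegaSum`). Since `𝒜` is an algebra, `Ω_J` is for any finite `J` a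
disjoint union of sets `p_j Ω_{K_j}` with `K_j` consisting of atoms, and injectivity lifts this to
an identity of formal sums (`exists_omegaSum_eq_sum`). The left side of the positivity condition is
the linear functional `[p] ↦ N(p)^{-β} Tr_τ^p(a)` applied to the formal sum of `J`, with `τ(a)` as
its value at `[e]`. It remains to see that it is nonnegative on the translate by `p` of the formal
sum of a set of atoms.

This follows from `Tr^{pq}(a) = lim_i ∑_{ξ ∈ H_i} Tr^q(⟨ξ, aξ⟩)`, where `∑_{ξ ∈ H_i} θ_{ξ,ξ}` is an
approximate unit for `X_p` (`tendsto_sum_fiberTrace`). The same net serves all `q`, so signed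
combinations pass to the limit, and the value on the translate is a limit of nonnegative
combinations of positivity expressions for atoms at the positive elements `⟨ξ, aξ⟩`.

All traces involved must be finite. A singleton `J = {p}` gives `Tr^p ≤ N(p)^β τ` for an atom `p`,
and Noetherian induction over factorisations gives `Tr^p ≤ C τ` for every `p ≠ e`
(`exists_inducedTrace_le`).

The analytic core is the limit formula. Operators are handled through the forms `x ↦ ⟨x, Tx⟩`.
Traciality shows that the supremum defining `Tr` is approached along any approximate unit
(`traceSum_le_traceSum_add`), and products of subunital families are subunital
(`inner_thetaSum_sigma_le`). -/

open Filter Topology TensorProduct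

/-! ### Elementary calculus of Hilbert modules -/

namespace CStarCorrespondence

variable {A : Type v} [NonUnitalCStarAlgebra A] [PartialOrder A] [StarOrderedRing A]
  (X : CStarCorrespondence.{v, w} A)

/-- The inner product as a linear map in its second variable. -/
def innerL (ξ : X.carrier) : X.carrier →ₗ[ℂ] A where
  toFun := X.inner ξ
  map_add' := X.inner_add ξ
  map_smul' c η := X.inner_smul c ξ η

theorem inner_zero_right (ξ : X.carrier) : X.inner ξ 0 = 0 := map_zero (X.innerL ξ)

theorem inner_sub_right (ξ η ζ : X.carrier) :
    X.inner ξ (η - ζ) = X.inner ξ η - X.inner ξ ζ := map_sub (X.innerL ξ) η ζ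

theorem inner_sum_right {ι : Type*} (s : Finset ι) (ξ : X.carrier) (η : ι → X.carrier) :
    X.inner ξ (∑ i ∈ s, η i) = ∑ i ∈ s, X.inner ξ (η i) := map_sum (X.innerL ξ) η s

theorem inner_real_smul_right (r : ℝ) (ξ η : X.carrier) :
    X.inner ξ (r • η) = r • X.inner ξ η := (X.innerL ξ).map_smul_of_tower r η

theorem inner_add_left (ξ η ζ : X.carrier) :
    X.inner (ξ + η) ζ = X.inner ξ ζ + X.inner η ζ := by
  rw [← X.star_inner, X.inner_add, star_add, X.star_inner, X.star_inner]

theorem inner_zero_left (ξ : X.carrier) : X.inner 0 ξ = 0 := by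
  rw [← X.star_inner, inner_zero_right, star_zero]

theorem inner_sub_left (ξ η ζ : X.carrier) :
    X.inner (ξ - η) ζ = X.inner ξ ζ - X.inner η ζ := by
  rw [← X.star_inner, inner_sub_right, star_sub, X.star_inner, X.star_inner]

theorem inner_sum_left {ι : Type*} (s : Finset ι) (ξ : ι → X.carrier) (η : X.carrier) :
    X.inner (∑ i ∈ s, ξ i) η = ∑ i ∈ s, X.inner (ξ i) η := by
  rw [← X.star_inner, inner_sum_right, star_sum]
  exact Finset.sum_congr rfl fun i _ => X.star_inner _ _

theorem inner_smul_left (c : ℂ) (ξ η : X.carrier) :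
    X.inner (c • ξ) η = star c • X.inner ξ η := by
  rw [← X.star_inner, X.inner_smul, star_smul, X.star_inner]

theorem inner_real_smul_left (r : ℝ) (ξ η : X.carrier) :
    X.inner (r • ξ) η = r • X.inner ξ η := by
  rw [← X.star_inner, inner_real_smul_right, star_smul, X.star_inner, star_trivial]

theorem inner_right_left (ξ η : X.carrier) (a : A) :
    X.inner (X.right ξ a) η = star a * X.inner ξ η := by
  rw [← X.star_inner, X.inner_right, star_mul, X.star_inner]

theorem eq_zero_of_inner_self {ξ : X.carrier} (h : X.inner ξ ξ = 0) : ξ = 0 := by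
  have := X.norm_sq ξ
  rw [h, norm_zero] at this
  exact norm_eq_zero.1 (pow_eq_zero_iff two_ne_zero |>.1 this)

theorem ext_inner {ξ η : X.carrier} (h : ∀ ζ, X.inner ζ ξ = X.inner ζ η) : ξ = η := by
  rw [← sub_eq_zero]
  refine X.eq_zero_of_inner_self ?_
  rw [inner_sub_right, h, sub_self]

/-- A linear operator that is its own adjoint for the `A`-valued inner product. -/
def IsSymm (T : Module.End ℂ X.carrier) : Prop :=
  ∀ x y, X.inner (T x) y = X.inner x (T y)

variable {X}

theorem IsSymm.mul {S T : Module.End ℂ X.carrier} (hS : X.IsSymm S) (hT : X.IsSymm T)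
    (h : Commute S T) : X.IsSymm (S * T) := fun x y => by
  rw [Module.End.mul_apply, hS, hT, ← Module.End.mul_apply, h.eq]

theorem IsSymm.one : X.IsSymm 1 := fun _ _ => rfl

theorem IsSymm.pow {T : Module.End ℂ X.carrier} (hT : X.IsSymm T) (n : ℕ) : X.IsSymm (T ^ n) := by
  induction n with
  | zero => exact IsSymm.one
  | succ n ih => rw [pow_succ]; exact ih.mul hT (Commute.pow_self T n)

theorem IsSymm.one_sub {T : Module.End ℂ X.carrier} (hT : X.IsSymm T) : X.IsSymm (1 - T) :=
  fun x y => by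
    simp only [LinearMap.sub_apply, Module.End.one_apply, inner_sub_left, inner_sub_right, hT x y]

/-- Expand `(δ - T)² ≥ 0` and use `T² ≤ δT` to get `δT ≤ δ²`. This replaces the spectral theorem in
the norm estimates below. -/
theorem IsSymm.inner_le_of_sq_le {T : Module.End ℂ X.carrier} (hT : X.IsSymm T) {δ : ℝ}
    (hδ : 0 < δ) (h : ∀ x, X.inner (T x) (T x) ≤ δ • X.inner x (T x)) (x : X.carrier) :
    X.inner x (T x) ≤ δ • X.inner x x := by
  have h1 := X.inner_self_nonneg (δ • x - T x)
  have h2 := h x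
  simp only [inner_sub_left, inner_sub_right, inner_real_smul_left, inner_real_smul_right,
    hT x x] at h1
  have h3 : δ • X.inner x (T x) ≤ δ • δ • X.inner x x := by
    rw [← sub_nonneg] at h2 ⊢
    have := add_nonneg h1 h2
    convert this using 1
    rw [smul_sub]
    abel
  exact le_of_smul_le_smul_of_pos_left h3 hδ

variable (X)

theorem star_mul_mul_le (a c : A) (ha : 0 ≤ a) {δ : ℝ} (h : ‖a‖ ≤ δ) :
    star c * a * c ≤ δ • (star c * c) :=
  (CStarAlgebra.star_left_conjugate_le_norm_smul (IsSelfAdjoint.of_nonneg ha)).trans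
    (smul_le_smul_of_nonneg_right h (star_mul_self_nonneg c))

/-- The rank one operator `η ↦ ξ ⟨ξ, η⟩`. -/
def theta (ξ : X.carrier) : Module.End ℂ X.carrier := (X.right ξ).comp (X.innerL ξ)

theorem theta_apply (ξ η : X.carrier) : X.theta ξ η = X.right ξ (X.inner ξ η) := rfl

theorem inner_theta (ξ η ζ : X.carrier) :
    X.inner η (X.theta ξ ζ) = X.inner η ξ * X.inner ξ ζ := X.inner_right _ _ _

theorem isSymm_theta (ξ : X.carrier) : X.IsSymm (X.theta ξ) := fun x y => by
  rw [inner_theta, theta_apply, inner_right_left, X.star_inner]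

theorem inner_right_right_le (ξ : X.carrier) (c : A) :
    X.inner (X.right ξ c) (X.right ξ c) ≤ (‖ξ‖ ^ 2) • (star c * c) := by
  rw [X.inner_right, inner_right_left]
  exact star_mul_mul_le _ _ (X.inner_self_nonneg ξ) (X.norm_sq ξ).ge

/-- Cauchy-Schwarz: `θ_{ξ,ξ}² ≤ ‖ξ‖² θ_{ξ,ξ}`, hence `θ_{ξ,ξ} ≤ ‖ξ‖²`. -/
theorem norm_inner_le (ξ η : X.carrier) : ‖X.inner ξ η‖ ≤ ‖ξ‖ * ‖η‖ := by
  rcases eq_or_ne ξ 0 with rfl | hξ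
  · simp [inner_zero_left]
  have h0 : 0 < ‖ξ‖ ^ 2 := by positivity
  have h := (X.isSymm_theta ξ).inner_le_of_sq_le h0 (fun x => by
    have e := X.inner_theta ξ x x
    rw [← X.star_inner ξ x] at e
    rw [e]
    exact X.inner_right_right_le _ _) η
  rw [inner_theta, ← X.star_inner ξ η] at h
  have h2 := CStarAlgebra.norm_le_norm_of_nonneg_of_le (star_mul_self_nonneg _) h
  rw [CStarRing.norm_star_mul_self, norm_smul, ← X.norm_sq, Real.norm_of_nonneg h0.le] at h2
  exact abs_le_of_sq_le_sq' (by nlinarith) (by positivity) |>.2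

/-- In `A` one has `e² ≤ ‖a‖² e` for `e = a*a`. The difference has the form `b*b`, so it acts as a
positive form, and `inner_le_of_sq_le` applies to the action of `e`. -/
theorem inner_left_left_le (a : A) (ζ : X.carrier) :
    X.inner (X.left a ζ) (X.left a ζ) ≤ (‖a‖ ^ 2) • X.inner ζ ζ := by
  rcases eq_or_ne a 0 with rfl | ha
  · simp [inner_zero_right]
  have hs : X.IsSymm (X.left (star a * a)) := fun x y => by
    rw [X.inner_left, star_mul, star_star]
  have h0 : 0 < ‖a‖ ^ 2 := by positivity
  have h := hs.inner_le_of_sq_le h0 (fun x => by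
    set e := star a * a with he
    have hse : star e = e := by rw [he, star_mul, star_star]
    have hn : 0 ≤ ‖a‖ ^ 2 • e - e * e := by
      rw [sub_nonneg]
      have := star_mul_mul_le (a * star a) a (mul_star_self_nonneg a)
        (CStarRing.norm_self_mul_star.trans (sq _).symm).le
      simpa only [he, mul_assoc] using this
    obtain ⟨b, hb⟩ := CStarAlgebra.nonneg_iff_eq_star_mul_self.1 hn
    rw [X.inner_left, hse, ← X.left_mul, ← inner_real_smul_right, ← sub_nonneg,
      ← inner_sub_right, ← LinearMap.smul_apply, ← LinearMap.map_smul_of_tower,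
      ← LinearMap.sub_apply, ← map_sub, hb, X.left_mul, ← star_star (star b), star_star b,
      ← X.inner_left]
    exact X.inner_self_nonneg _) ζ
  rwa [X.left_mul, ← star_star (star a), ← X.inner_left, star_star] at h

theorem norm_le_of_inner_le {ξ η : X.carrier} {r : ℝ} (hr : 0 ≤ r)
    (h : X.inner ξ ξ ≤ r ^ 2 • X.inner η η) : ‖ξ‖ ≤ r * ‖η‖ := by
  have h2 := CStarAlgebra.norm_le_norm_of_nonneg_of_le (X.inner_self_nonneg _) h
  rw [norm_smul, ← X.norm_sq, ← X.norm_sq, Real.norm_of_nonneg (by positivity)] at h2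
  exact abs_le_of_sq_le_sq' (by nlinarith) (by positivity) |>.2

theorem norm_left_le (a : A) (ζ : X.carrier) : ‖X.left a ζ‖ ≤ ‖a‖ * ‖ζ‖ :=
  X.norm_le_of_inner_le (norm_nonneg a) (X.inner_left_left_le a ζ)

theorem inner_left_nonneg {a : A} (ha : 0 ≤ a) (ξ : X.carrier) : 0 ≤ X.inner ξ (X.left a ξ) := by
  obtain ⟨b, rfl⟩ := CStarAlgebra.nonneg_iff_eq_star_mul_self.1 ha
  rw [X.left_mul, ← star_star (star b), ← X.inner_left, star_star]
  exact X.inner_self_nonneg _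

/-! ### Positive contractions -/

/-- `T` is self-adjoint with `0 ≤ T ≤ 1`. -/
structure IsPosContr (T : Module.End ℂ X.carrier) : Prop where
  symm : X.IsSymm T
  nonneg : ∀ x, 0 ≤ X.inner x (T x)
  le_one : ∀ x, X.inner x (T x) ≤ X.inner x x

variable {X} {T : Module.End ℂ X.carrier}

theorem IsPosContr.one_sub (hT : X.IsPosContr T) : X.IsPosContr (1 - T) where
  symm := hT.symm.one_sub
  nonneg x := by
    rw [LinearMap.sub_apply, inner_sub_right]; exact sub_nonneg.2 (hT.le_one x)
  le_one x := by
    rw [LinearMap.sub_apply, inner_sub_right]; exact sub_le_self _ (hT.nonneg x)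

/-- `T - T² = T(1 - T)T + (1 - T)T(1 - T)`. -/
theorem IsPosContr.inner_sq_le (hT : X.IsPosContr T) (x : X.carrier) :
    X.inner (T x) (T x) ≤ X.inner x (T x) := by
  have h1 := hT.one_sub.nonneg (T x)
  have h2 := hT.nonneg ((1 - T) x)
  rw [← sub_nonneg]
  have h3 := add_nonneg h1 h2
  simp only [LinearMap.sub_apply, Module.End.one_apply, map_sub, inner_sub_right,
    inner_sub_left, hT.symm x] at h3 ⊢
  convert h3 using 1
  abel

/-- With `U = 1 - T`, `U - TUT = U² + UTU`. -/
theorem IsPosContr.inner_apply_le (hT : X.IsPosContr T) (x : X.carrier) :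
    X.inner (T x) ((1 - T) (T x)) ≤ X.inner x ((1 - T) x) := by
  have h1 := X.inner_self_nonneg ((1 - T) x)
  have h2 := hT.nonneg ((1 - T) x)
  rw [← sub_nonneg]
  have h3 := add_nonneg h1 h2
  simp only [LinearMap.sub_apply, Module.End.one_apply, map_sub, inner_sub_right,
    inner_sub_left, hT.symm x] at h3 ⊢
  convert h3 using 1
  abel

theorem IsPosContr.norm_apply_le (hT : X.IsPosContr T) (x : X.carrier) : ‖T x‖ ≤ ‖x‖ := by
  simpa using X.norm_le_of_inner_le zero_le_one
    (by simpa using (hT.inner_sq_le x).trans (hT.le_one x) : X.inner (T x) (T x) ≤ _)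

theorem IsPosContr.norm_pow_apply_le (hT : X.IsPosContr T) (n : ℕ) (x : X.carrier) :
    ‖(T ^ n) x‖ ≤ ‖x‖ := by
  induction n with
  | zero => simp
  | succ n ih => rw [pow_succ', Module.End.mul_apply]; exact (hT.norm_apply_le _).trans ih

/-- The forms `T^k (1 - T) T^k` decrease in `k`, and each is at most `T^{2k} - T^{2k+2}`; summing
over `k < n` telescopes. It follows that `T^n (1 - T) T^n` decays like `1/n`. -/
theorem IsPosContr.nsmul_inner_pow_le (hT : X.IsPosContr T) (n : ℕ) (x : X.carrier) :
    (n : ℝ) • X.inner ((T ^ n) x) ((1 - T) ((T ^ n) x)) + X.inner ((T ^ n) x) ((T ^ n) x) ≤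
      X.inner x x := by
  induction n with
  | zero => simp
  | succ n ih =>
    refine le_trans ?_ ih
    rw [pow_succ', Module.End.mul_apply]
    set y := (T ^ n) x
    have h1 := smul_le_smul_of_nonneg_left (hT.inner_apply_le y) (Nat.cast_nonneg (α := ℝ) n)
    have h2 := hT.inner_apply_le y
    have h3 := hT.inner_sq_le y
    have h4 : X.inner y ((1 - T) y) + X.inner (T y) (T y) ≤ X.inner y y := by
      rw [LinearMap.sub_apply, inner_sub_right, Module.End.one_apply]
      rw [← sub_nonneg] at h3 ⊢
      convert h3 using 1
      abel
    rw [Nat.cast_succ, add_smul, one_smul, add_assoc]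
    exact add_le_add h1 ((add_le_add_left h2 _).trans h4)

theorem IsPosContr.norm_inner_pow_le (hT : X.IsPosContr T) (n : ℕ) (x : X.carrier) :
    n * ‖X.inner ((T ^ n) x) ((1 - T) ((T ^ n) x))‖ ≤ ‖x‖ ^ 2 := by
  have h0 := hT.one_sub.nonneg ((T ^ n) x)
  have h := (le_add_of_nonneg_right (X.inner_self_nonneg _)).trans (hT.nsmul_inner_pow_le n x)
  have := CStarAlgebra.norm_le_norm_of_nonneg_of_le
    (smul_nonneg (Nat.cast_nonneg (α := ℝ) n) h0) h
  rwa [norm_smul, ← X.norm_sq, Real.norm_natCast] at this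

theorem IsPosContr.tendsto_inner_pow (hT : X.IsPosContr T) (x : X.carrier) :
    Tendsto (fun n : ℕ => X.inner ((T ^ n) x) ((1 - T) ((T ^ n) x))) atTop (𝓝 0) := by
  rw [tendsto_zero_iff_norm_tendsto_zero]
  refine squeeze_zero' (.of_forall fun _ => norm_nonneg _)
    (eventually_atTop.2 ⟨1, fun n hn => ?_⟩)
    (tendsto_const_div_atTop_nhds_zero_nat (‖x‖ ^ 2))
  rw [le_div_iff₀ (by exact_mod_cast hn), mul_comm]
  exact hT.norm_inner_pow_le n x

theorem IsPosContr.tendsto_pow_mul_pow (hT : X.IsPosContr T) (x : X.carrier) :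
    Tendsto (fun n : ℕ => (T ^ n * (1 - T) * T ^ n) x) atTop (𝓝 0) := by
  have h1 := (hT.tendsto_inner_pow x).norm.sqrt
  rw [norm_zero, Real.sqrt_zero] at h1
  refine squeeze_zero_norm (fun n => ?_) h1
  rw [Module.End.mul_apply, Module.End.mul_apply]
  refine (hT.norm_pow_apply_le n _).trans (Real.le_sqrt_of_sq_le ?_)
  rw [X.norm_sq]
  exact CStarAlgebra.norm_le_norm_of_nonneg_of_le (X.inner_self_nonneg _)
    (hT.one_sub.inner_sq_le _)

end CStarCorrespondence

/-! ### From indexed families to finite sets of vectors -/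

theorem Complex.infinite_unit_circle : {z : ℂ | ‖z‖ = 1}.Infinite := by
  refine Set.infinite_of_injOn_mapsTo (s := Set.Ioo (-Real.pi) Real.pi)
    (f := fun t : ℝ => Complex.exp (t * Complex.I)) ?_ ?_
    (Set.Ioo_infinite (by linarith [Real.pi_pos]))
  · intro x hx y hy h
    have h' := congrArg Complex.arg h
    simp only at h'
    rwa [Complex.arg_exp_mul_I, Complex.arg_exp_mul_I,
      (toIocMod_eq_self Real.two_pi_pos).2 ⟨hx.1, by linarith [hx.2]⟩,
      (toIocMod_eq_self Real.two_pi_pos).2 ⟨hy.1, by linarith [hy.2]⟩] at h'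
  · intro x _
    exact Complex.norm_exp_ofReal_mul_I x

/-- The nonzero members of a finite family become distinct after multiplication by suitable
scalars of modulus one. -/
theorem exists_unimodular_injOn {E ι : Type*} [AddCommGroup E] [Module ℂ E] (s : Finset ι)
    (ξ : ι → E) : ∃ z : ι → ℂ, (∀ i, ‖z i‖ = 1) ∧
      Set.InjOn (fun i => z i • ξ i) {i | i ∈ s ∧ ξ i ≠ 0} := by
  classical
  induction s using Finset.induction_on with
  | empty => exact ⟨fun _ => 1, fun _ => norm_one, by simp⟩
  | insert i s hi ih =>
    obtain ⟨z, hz, hinj⟩ := ih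
    by_cases h0 : ξ i = 0
    · refine ⟨z, hz, hinj.mono ?_⟩
      rintro j ⟨hj, hj0⟩
      rcases Finset.mem_insert.1 hj with rfl | hj
      · exact absurd h0 hj0
      · exact ⟨hj, hj0⟩
    -- A nonzero vector has infinitely many unimodular multiples, and only finitely many values are
    -- taken.
    · obtain ⟨c, hc, hcn⟩ : ∃ c : ℂ, ‖c‖ = 1 ∧ c • ξ i ∉ s.image fun j => z j • ξ j := by
        have hinf : ((fun c : ℂ => c • ξ i) '' {c | ‖c‖ = 1}).Infinite :=
          Complex.infinite_unit_circle.image (smul_left_injective ℂ h0).injOn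
        obtain ⟨_, ⟨c, hc, rfl⟩, hn⟩ := hinf.exists_notMem_finset (s.image fun j => z j • ξ j)
        exact ⟨c, hc, hn⟩
      have hne : ∀ j ∈ s, z j • ξ j ≠ c • ξ i := fun j hj h =>
        hcn (Finset.mem_image.2 ⟨j, hj, h⟩)
      have hup : ∀ j ∈ s, Function.update z i c j = z j := fun j hj =>
        Function.update_of_ne (by rintro rfl; exact hi hj) _ _
      refine ⟨Function.update z i c, fun j => ?_, ?_⟩
      · rcases eq_or_ne j i with rfl | hj
        · rwa [Function.update_self]
        · rw [Function.update_of_ne hj]; exact hz j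
      · rintro j ⟨hj, hj0⟩ k ⟨hk, hk0⟩ h
        simp only at h
        rcases Finset.mem_insert.1 hj with rfl | hj' <;>
          rcases Finset.mem_insert.1 hk with rfl | hk'
        · rfl
        · rw [Function.update_self, hup k hk'] at h
          exact absurd h.symm (hne k hk')
        · rw [Function.update_self, hup j hj'] at h
          exact absurd h (hne j hj')
        · rw [hup j hj', hup k hk'] at h
          exact hinj ⟨hj', hj0⟩ ⟨hk', hk0⟩ h

theorem exists_finset_sum_eq {E ι : Type*} [AddCommGroup E] [Module ℂ E] (s : Finset ι)
    (ξ : ι → E) : ∃ (H : Finset E) (t : Finset ι) (z : ι → ℂ), t ⊆ s ∧ (∀ i, ‖z i‖ = 1) ∧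
      (∀ i ∈ s, i ∉ t → ξ i = 0) ∧ Set.InjOn (fun i => z i • ξ i) t ∧
      (H : Set E) = (fun i => z i • ξ i) '' t := by
  classical
  obtain ⟨z, hz, hinj⟩ := exists_unimodular_injOn s ξ
  refine ⟨(s.filter fun i => ξ i ≠ 0).image fun i => z i • ξ i, s.filter fun i => ξ i ≠ 0, z,
    Finset.filter_subset _ _, hz, fun i hi h => ?_, ?_, by simp⟩
  · by_contra h0
    exact h (Finset.mem_filter.2 ⟨hi, h0⟩)
  · exact hinj.mono fun i hi => Finset.mem_filter.1 hi

theorem finset_sum_eq_of_unimodular {E ι B : Type*} [AddCommGroup E] [Module ℂ E]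
    [AddCommMonoid B] {s t : Finset ι} {ξ : ι → E} {H : Finset E} {z : ι → ℂ} (hts : t ⊆ s)
    (hz : ∀ i, ‖z i‖ = 1) (h0 : ∀ i ∈ s, i ∉ t → ξ i = 0)
    (hinj : Set.InjOn (fun i => z i • ξ i) t) (hH : (H : Set E) = (fun i => z i • ξ i) '' t)
    (f : E → B) (hf0 : f 0 = 0) (hf : ∀ z : ℂ, ‖z‖ = 1 → ∀ x, f (z • x) = f x) :
    ∑ x ∈ H, f x = ∑ i ∈ s, f (ξ i) := by
  classical
  have hH' : H = t.image fun i => z i • ξ i := by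
    rw [← Finset.coe_inj, hH, Finset.coe_image]
  rw [hH', Finset.sum_image hinj, ← Finset.sum_subset hts fun i hi hit => by rw [h0 i hi hit, hf0]]
  exact Finset.sum_congr rfl fun i _ => hf _ (hz i) _

/-! ### Tracial states -/

namespace TracialState

variable {A : Type v} [NonUnitalCStarAlgebra A] [PartialOrder A] (τ : TracialState A)

/-- The real part of a tracial state. -/
noncomputable def re : A →ₗ[ℝ] ℝ := Complex.reLm.comp (τ.toFun.restrictScalars ℝ)

theorem re_apply (a : A) : τ.re a = (τ.toFun a).re := rfl

theorem re_nonneg {a : A} (ha : 0 ≤ a) : 0 ≤ τ.re a := (Complex.le_def.1 (τ.nonneg a ha)).1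

theorem re_mono [IsOrderedAddMonoid A] {a b : A} (h : a ≤ b) : τ.re a ≤ τ.re b := by
  have := τ.re_nonneg (sub_nonneg.2 h)
  rwa [map_sub, sub_nonneg] at this

theorem re_mul_comm (a b : A) : τ.re (a * b) = τ.re (b * a) := by
  rw [re_apply, re_apply, τ.trace]

theorem norm_toFun_le (a : A) : ‖τ.toFun a‖ ≤ ‖a‖ := by
  rcases eq_or_ne a 0 with rfl | ha
  · simp
  have h0 : 0 < ‖a‖ := norm_pos_iff.2 ha
  have h := τ.norm_eq_one.1 ⟨((‖a‖ : ℂ)⁻¹) • a, by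
    rw [norm_smul, norm_inv, Complex.norm_real, norm_norm, inv_mul_cancel₀ h0.ne'], rfl⟩
  rw [map_smul, smul_eq_mul, norm_mul, norm_inv, Complex.norm_real, norm_norm,
    inv_mul_le_iff₀ h0, mul_one] at h
  exact h

theorem re_le_norm (a : A) : τ.re a ≤ ‖a‖ :=
  (Complex.re_le_norm _).trans (τ.norm_toFun_le a)

end TracialState

/-! ### Finite sums of rank one operators -/

namespace CStarCorrespondence

variable {A : Type v} [NonUnitalCStarAlgebra A] [PartialOrder A] [StarOrderedRing A]
  (X : CStarCorrespondence.{v, w} A)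

/-- The operator `∑_{i ∈ s} θ_{ξ_i,ξ_i}`. -/
def thetaSum {ι : Type*} (s : Finset ι) (ξ : ι → X.carrier) : Module.End ℂ X.carrier :=
  ∑ i ∈ s, X.theta (ξ i)

section thetaSum

variable {ι : Type*} (s : Finset ι) (ξ : ι → X.carrier)

theorem thetaSum_apply (η : X.carrier) :
    X.thetaSum s ξ η = ∑ i ∈ s, X.right (ξ i) (X.inner (ξ i) η) := by
  simp only [thetaSum, LinearMap.sum_apply, theta_apply]

theorem inner_thetaSum (η ζ : X.carrier) :
    X.inner η (X.thetaSum s ξ ζ) = ∑ i ∈ s, X.inner η (ξ i) * X.inner (ξ i) ζ := by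
  simp only [thetaSum_apply, inner_sum_right, X.inner_right]

theorem isSymm_thetaSum : X.IsSymm (X.thetaSum s ξ) := fun x y => by
  simp only [thetaSum, LinearMap.sum_apply, inner_sum_left, inner_sum_right]
  exact Finset.sum_congr rfl fun i _ => X.isSymm_theta (ξ i) x y

theorem inner_thetaSum_nonneg (η : X.carrier) : 0 ≤ X.inner η (X.thetaSum s ξ η) := by
  rw [inner_thetaSum]
  refine Finset.sum_nonneg fun i _ => ?_
  rw [← X.star_inner (ξ i) η]
  exact star_mul_self_nonneg _

variable {X s ξ}

theorem isPosContr_thetaSum (h : ∀ η, X.inner η (X.thetaSum s ξ η) ≤ X.inner η η) :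
    X.IsPosContr (X.thetaSum s ξ) :=
  ⟨X.isSymm_thetaSum s ξ, X.inner_thetaSum_nonneg s ξ, h⟩

theorem isSubunital_iff {H : Finset X.carrier} :
    X.IsSubunital H ↔ ∀ η, X.inner η (X.thetaSum H id η) ≤ X.inner η η := by
  simp only [IsSubunital, thetaSum_apply, id]

theorem IsSubunital.isPosContr {H : Finset X.carrier} (h : X.IsSubunital H) :
    X.IsPosContr (X.thetaSum H id) := isPosContr_thetaSum (isSubunital_iff.1 h)

variable (X s ξ)

theorem theta_smul {z : ℂ} (hz : ‖z‖ = 1) (x : X.carrier) : X.theta (z • x) = X.theta x := by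
  refine LinearMap.ext fun η => X.ext_inner fun ζ => ?_
  rw [inner_theta, inner_theta, X.inner_smul, inner_smul_left, smul_mul_smul_comm,
    show z * star z = 1 by
      rw [← starRingEnd_apply, Complex.mul_conj, Complex.normSq_eq_norm_sq, hz]; simp, one_smul]

theorem inner_left_smul {z : ℂ} (hz : ‖z‖ = 1) (a : A) (x : X.carrier) :
    X.inner (z • x) (X.left a (z • x)) = X.inner x (X.left a x) := by
  rw [map_smul, X.inner_smul, inner_smul_left, smul_smul,
    show z * star z = 1 by
      rw [← starRingEnd_apply, Complex.mul_conj, Complex.normSq_eq_norm_sq, hz]; simp, one_smul]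

/-- The induced trace is a supremum over sets, whereas constructions yield families with possible
repetitions. Unimodular scalars separate repeated vectors and change neither `θ_{ξ,ξ}` nor `⟨ξ,
aξ⟩`; zero vectors are dropped. -/
theorem exists_finset_thetaSum_eq : ∃ H : Finset X.carrier,
    X.thetaSum H id = X.thetaSum s ξ ∧ ∀ (τ : TracialState A) (a : A),
      ∑ x ∈ H, τ.re (X.inner x (X.left a x)) =
        ∑ i ∈ s, τ.re (X.inner (ξ i) (X.left a (ξ i))) := by
  obtain ⟨H, t, z, hts, hz, h0, hinj, hH⟩ := exists_finset_sum_eq s ξ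
  refine ⟨H, finset_sum_eq_of_unimodular hts hz h0 hinj hH X.theta ?_ ?_, fun τ a =>
    finset_sum_eq_of_unimodular hts hz h0 hinj hH
      (fun x => τ.re (X.inner x (X.left a x))) ?_ ?_⟩
  · exact LinearMap.ext fun η => by simp [theta_apply]
  · exact fun z hz x => X.theta_smul hz x
  · simp [inner_zero_left]
  · intro z hz x
    simp only [X.inner_left_smul hz]

/-- Expand `∑_{i,j} ⟨x_i - x_j, x_i - x_j⟩ ≥ 0`. -/
theorem inner_sum_self_le (x : ι → X.carrier) :
    X.inner (∑ i ∈ s, x i) (∑ i ∈ s, x i) ≤ (s.card : ℝ) • ∑ i ∈ s, X.inner (x i) (x i) := by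
  have h : 0 ≤ ∑ i ∈ s, ∑ j ∈ s, X.inner (x i - x j) (x i - x j) :=
    Finset.sum_nonneg fun i _ => Finset.sum_nonneg fun j _ => X.inner_self_nonneg _
  simp only [inner_sub_left, inner_sub_right, Finset.sum_sub_distrib, Finset.sum_const,
    ← inner_sum_left, ← inner_sum_right, ← Finset.smul_sum] at h
  have h2 : (2 : ℝ) • X.inner (∑ i ∈ s, x i) (∑ i ∈ s, x i) ≤
      (2 : ℝ) • (s.card : ℝ) • ∑ i ∈ s, X.inner (x i) (x i) := by
    rw [← sub_nonneg]
    convert h using 1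
    rw [two_smul, two_smul, ← Nat.cast_smul_eq_nsmul ℝ]
    abel
  exact le_of_smul_le_smul_of_pos_left h2 two_pos

theorem inner_thetaSum_sq_le {δ : ℝ} (h : ∀ i ∈ s, s.card * ‖ξ i‖ ^ 2 ≤ δ) (η : X.carrier) :
    X.inner (X.thetaSum s ξ η) (X.thetaSum s ξ η) ≤ δ • X.inner η (X.thetaSum s ξ η) := by
  rw [inner_thetaSum _ _ _ η, thetaSum_apply]
  refine (X.inner_sum_self_le s _).trans ?_
  rw [Finset.smul_sum, Finset.smul_sum]
  refine Finset.sum_le_sum fun i hi => ?_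
  refine (smul_le_smul_of_nonneg_left (X.inner_right_right_le _ _) (Nat.cast_nonneg _)).trans ?_
  rw [smul_smul, X.star_inner]
  refine smul_le_smul_of_nonneg_right (h i hi) ?_
  rw [← X.star_inner (ξ i) η]
  exact star_mul_self_nonneg _

end thetaSum

end CStarCorrespondence

/-! ### Approximate units made of rank one sums -/

namespace CStarCorrespondence

variable {A : Type v} [NonUnitalCStarAlgebra A] [PartialOrder A] [StarOrderedRing A]
  {X : CStarCorrespondence.{v, w} A}

/-- With `U = 1 - T`, `1 - U² = 2T - T²`; conjugating by `U^j` and summing telescopes. -/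
theorem IsSymm.inner_apply_sum_pow {T : Module.End ℂ X.carrier} (hT : X.IsSymm T)
    (x : X.carrier) (m : ℕ) :
    X.inner x x = ∑ j ∈ Finset.range m,
      ((2 : ℝ) • X.inner (((1 - T) ^ j) x) (T (((1 - T) ^ j) x)) -
        X.inner (T (((1 - T) ^ j) x)) (T (((1 - T) ^ j) x))) +
      X.inner (((1 - T) ^ m) x) (((1 - T) ^ m) x) := by
  induction m with
  | zero => simp
  | succ m ih =>
    rw [ih, Finset.sum_range_succ, add_assoc]
    congr 1
    rw [pow_succ' (1 - T) m, Module.End.mul_apply]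
    set y := ((1 - T) ^ m) x
    simp only [LinearMap.sub_apply, Module.End.one_apply, inner_sub_left, inner_sub_right,
      hT y, two_smul]
    abel

/-- Put `y = (1 - T)^{2k} ξ_i`. Then `‖(1 - T)^k ξ_i‖² = ‖⟨ξ_i, y⟩‖`, and `θ_{ξ_i,ξ_i} ≤ T` gives
`‖⟨ξ_i, y⟩‖² ≤ ‖⟨y, Ty⟩‖`. The last norm tends to zero by `tendsto_inner_pow` for `1 - T`. -/
theorem tendsto_one_sub_thetaSum_pow {ι : Type*} {s : Finset ι} {ξ : ι → X.carrier}
    (h : X.IsPosContr (X.thetaSum s ξ)) {i : ι} (hi : i ∈ s) :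
    Tendsto (fun k : ℕ => ((1 - X.thetaSum s ξ) ^ k) (ξ i)) atTop (𝓝 0) := by
  set T := X.thetaSum s ξ with hT
  have h1 := h.one_sub.tendsto_inner_pow (ξ i)
  rw [sub_sub_cancel] at h1
  have h2 : Tendsto (fun k : ℕ => k + k) atTop atTop :=
    tendsto_atTop_mono (fun k => Nat.le_add_left k k) tendsto_id
  have h3 := (h1.comp h2).norm.sqrt.sqrt
  rw [norm_zero, Real.sqrt_zero, Real.sqrt_zero] at h3
  refine squeeze_zero_norm (fun k => ?_) h3
  refine Real.le_sqrt_of_sq_le (Real.le_sqrt_of_sq_le ?_)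
  rw [X.norm_sq, h.one_sub.symm.pow k, ← Module.End.mul_apply, ← pow_add, Function.comp_apply]
  set y := ((1 - T) ^ (k + k)) (ξ i)
  rw [sq, ← CStarRing.norm_star_mul_self, X.star_inner]
  have hle : X.inner y (ξ i) * X.inner (ξ i) y ≤ X.inner y (T y) := by
    rw [hT, inner_thetaSum]
    refine Finset.single_le_sum (f := fun j => X.inner y (ξ j) * X.inner (ξ j) y)
      (fun j _ => ?_) hi
    rw [← X.star_inner (ξ j) y]
    exact star_mul_self_nonneg _
  refine CStarAlgebra.norm_le_norm_of_nonneg_of_le ?_ hle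
  rw [← X.star_inner (ξ i) y]
  exact star_mul_self_nonneg _

/-- For positive contractive `T = ∑ θ_{ξ_i,ξ_i}` with `T² ≤ δT`, a multiple of
`∑_{j < m} (1 - T)^j T (1 - T)^j` is again of the form `∑ θ_{η,η}` and approximates `1`. -/
theorem exists_isSubunital_of_sq_le {ι : Type*} (s : Finset ι) (ξ : ι → X.carrier) {δ : ℝ}
    (hδ0 : 0 < δ) (hδ1 : δ ≤ 1)
    (h : ∀ η, X.inner (X.thetaSum s ξ η) (X.thetaSum s ξ η) ≤ δ • X.inner η (X.thetaSum s ξ η))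
    (m : ℕ) : ∃ H : Finset X.carrier, X.IsSubunital H ∧ ∀ η,
      X.inner η ((1 - X.thetaSum H id) η) ≤ δ • X.inner η η +
        X.inner (((1 - X.thetaSum s ξ) ^ m) η) (((1 - X.thetaSum s ξ) ^ m) η) := by
  set T := X.thetaSum s ξ with hT
  have hsymm : X.IsSymm T := X.isSymm_thetaSum s ξ
  have hpos : ∀ η, 0 ≤ X.inner η (T η) := X.inner_thetaSum_nonneg s ξ
  -- The factor `2 - δ` is what `T² ≤ δT` allows: `(2 - δ)T ≤ 2T - T²`, and the conjugates of the
  -- right side sum to at most `1` by `inner_apply_sum_pow`.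
  obtain ⟨H, hH, -⟩ := X.exists_finset_thetaSum_eq (Finset.range m ×ˢ s)
    (fun p => (√(2 - δ)) • ((1 - T) ^ p.1) (ξ p.2))
  have hq : ∀ η, X.inner η (X.thetaSum H id η) =
      (2 - δ) • ∑ j ∈ Finset.range m, X.inner (((1 - T) ^ j) η) (T (((1 - T) ^ j) η)) := by
    intro η
    rw [hH, inner_thetaSum, Finset.sum_product, Finset.smul_sum]
    refine Finset.sum_congr rfl fun j _ => ?_
    rw [hT, inner_thetaSum, Finset.smul_sum, ← hT]
    refine Finset.sum_congr rfl fun i _ => ?_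
    rw [inner_real_smul_left, inner_real_smul_right, smul_mul_smul_comm,
      Real.mul_self_sqrt (by linarith), ← hsymm.one_sub.pow j, hsymm.one_sub.pow j (ξ i)]
  have hid := fun η => hsymm.inner_apply_sum_pow η m
  have hsum0 : ∀ η, 0 ≤ ∑ j ∈ Finset.range m,
      X.inner (((1 - T) ^ j) η) (T (((1 - T) ^ j) η)) := fun η =>
    Finset.sum_nonneg fun j _ => hpos _
  have hsub : X.IsSubunital H := isSubunital_iff.2 fun η => by
    rw [hq, hid η, Finset.smul_sum]
    refine le_add_of_le_of_nonneg (Finset.sum_le_sum fun j _ => ?_) (X.inner_self_nonneg _)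
    rw [sub_smul]
    exact sub_le_sub_left (h _) _
  refine ⟨H, hsub, fun η => ?_⟩
  have h1 := isSubunital_iff.1 hsub η
  rw [LinearMap.sub_apply, inner_sub_right, Module.End.one_apply]
  rw [hq] at h1 ⊢
  have h2 : X.inner η η ≤ (2 : ℝ) • ∑ j ∈ Finset.range m,
      X.inner (((1 - T) ^ j) η) (T (((1 - T) ^ j) η)) +
      X.inner (((1 - T) ^ m) η) (((1 - T) ^ m) η) := by
    rw [hid η, Finset.smul_sum]
    exact add_le_add_left (Finset.sum_le_sum fun j _ =>
      sub_le_self _ (X.inner_self_nonneg _)) _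
  set Q := ∑ j ∈ Finset.range m, X.inner (((1 - T) ^ j) η) (T (((1 - T) ^ j) η))
  have h3 : Q ≤ X.inner η η := by
    refine le_trans ?_ h1
    conv_lhs => rw [← one_smul ℝ Q]
    exact smul_le_smul_of_nonneg_right (by linarith) (hsum0 η)
  have h4 := smul_le_smul_of_nonneg_left h3 hδ0.le
  rw [sub_le_iff_le_add]
  refine h2.trans ?_
  rw [← sub_nonneg] at h4 ⊢
  convert h4 using 1
  rw [sub_smul]
  abel

theorem exists_isSubunital_approx (F : Finset X.carrier) {ε : ℝ} (hε : 0 < ε) :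
    ∃ H : Finset X.carrier, X.IsSubunital H ∧ ∀ η ∈ F, ‖η - X.thetaSum H id η‖ ≤ ε := by
  obtain ⟨M, hM1, hM⟩ : ∃ M : ℝ, 1 ≤ M ∧ ∀ η ∈ F, ‖η‖ ≤ M := by
    refine ⟨1 + ∑ η ∈ F, ‖η‖, by simpa using Finset.sum_nonneg fun η _ => norm_nonneg _,
      fun η hη => ?_⟩
    linarith [Finset.single_le_sum (f := fun η : X.carrier => ‖η‖) (fun _ _ => norm_nonneg _) hη]
  have hM0 : 0 < M := by linarith
  -- The error has two terms, `δ⟨η, η⟩` and the remainder with `(1 - T)^m`; each is given `ε²/2`.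
  obtain ⟨δ, hδ0, hδ1, hδε⟩ : ∃ δ : ℝ, 0 < δ ∧ δ ≤ 1 ∧ δ * M ^ 2 ≤ ε ^ 2 / 2 :=
    ⟨min 1 (ε ^ 2 / 2 / M ^ 2), by positivity, min_le_left _ _, by
      rw [← le_div_iff₀ (by positivity)]; exact min_le_right _ _⟩
  -- Scaling by `c` yields `|F| ‖cη‖² ≤ δ` on `F`, as `inner_thetaSum_sq_le` requires; `+ 1` covers
  -- empty `F`.
  set c : ℝ := √(δ / ((F.card + 1) * M ^ 2)) with hc
  have hc0 : 0 < c := Real.sqrt_pos.2 (by positivity)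
  have hc2 : (F.card + 1) * (c ^ 2 * M ^ 2) = δ := by
    rw [hc, Real.sq_sqrt (by positivity)]; field_simp
  have hT := X.inner_thetaSum_sq_le F (fun η => c • η) (δ := δ) (fun η hη => by
    rw [← hc2, norm_smul, Real.norm_of_nonneg hc0.le, mul_pow]
    have := hM η hη
    gcongr
    linarith)
  have hP : X.IsPosContr (X.thetaSum F fun η => c • η) := isPosContr_thetaSum fun η => by
    refine ((X.isSymm_thetaSum _ _).inner_le_of_sq_le hδ0 hT η).trans ?_
    conv_rhs => rw [← one_smul ℝ (X.inner η η)]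
    exact smul_le_smul_of_nonneg_right hδ1 (X.inner_self_nonneg η)
  have hev : ∀ᶠ k : ℕ in Filter.atTop, ∀ η ∈ F,
      ‖((1 - X.thetaSum F fun η => c • η) ^ k) η‖ ^ 2 ≤ ε ^ 2 / 2 := by
    refine (Filter.eventually_all_finset F).2 fun η hη => ?_
    have h1 := ((tendsto_one_sub_thetaSum_pow hP hη).const_smul c⁻¹).norm.pow 2
    simp only [LinearMap.map_smul_of_tower, inv_smul_smul₀ hc0.ne', smul_zero, norm_zero,
      ne_eq, OfNat.ofNat_ne_zero, not_false_eq_true, zero_pow] at h1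
    exact h1.eventually_le_const (by positivity)
  obtain ⟨m, hm⟩ := hev.exists
  obtain ⟨H, hH, hle⟩ := exists_isSubunital_of_sq_le F _ hδ0 hδ1 hT m
  refine ⟨H, hH, fun η hη => ?_⟩
  have hW := hH.isPosContr.one_sub
  have h1 := CStarAlgebra.norm_le_norm_of_nonneg_of_le (X.inner_self_nonneg _)
    ((hW.inner_sq_le η).trans (hle η))
  rw [← X.norm_sq] at h1
  have h2 := h1.trans (norm_add_le _ _)
  rw [norm_smul, ← X.norm_sq, ← X.norm_sq, Real.norm_of_nonneg hδ0.le] at h2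
  have h3 := hm η hη
  have h4 : δ * ‖η‖ ^ 2 ≤ δ * M ^ 2 := by
    have := hM η hη
    gcongr
  exact abs_le_of_sq_le_sq' (by
    rw [LinearMap.sub_apply, Module.End.one_apply] at h2; linarith) hε.le |>.2

/-! ### Traces of finite families -/

variable (X) (τ : TracialState A)

/-- The number `∑_{i ∈ s} τ(⟨ξ_i, a ξ_i⟩)`. -/
noncomputable def traceSum {ι : Type*} (s : Finset ι) (ξ : ι → X.carrier) (a : A) : ℝ :=
  ∑ i ∈ s, τ.re (X.inner (ξ i) (X.left a (ξ i)))

variable {X}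

theorem traceSum_le_inducedTrace {ι : Type*} {s : Finset ι} {ξ : ι → X.carrier}
    (h : ∀ η, X.inner η (X.thetaSum s ξ η) ≤ X.inner η η) (a : A) :
    ENNReal.ofReal (X.traceSum τ s ξ a) ≤ X.inducedTrace τ a := by
  obtain ⟨H, hH, hsum⟩ := X.exists_finset_thetaSum_eq s ξ
  rw [traceSum, ← hsum]
  exact le_iSup₂_of_le (f := fun (H : Finset X.carrier) (_ : X.IsSubunital H) =>
    ENNReal.ofReal (∑ ξ ∈ H, (τ.toFun (X.inner ξ (X.left a ξ))).re)) H
    (isSubunital_iff.2 (hH ▸ h)) le_rfl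

theorem inducedTrace_le {a : A} {c : ℝ≥0∞}
    (h : ∀ H, X.IsSubunital H → ENNReal.ofReal (X.traceSum τ H id a) ≤ c) :
    X.inducedTrace τ a ≤ c :=
  iSup₂_le h

/-- If the induced trace is infinite, its `toReal` is `0` and the empty family serves, so no
finiteness is assumed. -/
theorem exists_le_traceSum_add (a : A) {ε : ℝ} (hε : 0 < ε) :
    ∃ H, X.IsSubunital H ∧ (X.inducedTrace τ a).toReal ≤ X.traceSum τ H id a + ε := by
  by_contra! hcon
  have h1 : X.inducedTrace τ a ≤ ENNReal.ofReal ((X.inducedTrace τ a).toReal - ε) :=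
    inducedTrace_le τ fun H hH =>
      ENNReal.ofReal_le_ofReal (by linarith [hcon H hH])
  have h0 : 0 < (X.inducedTrace τ a).toReal := by
    have h3 : X.IsSubunital (∅ : Finset X.carrier) := fun η => by
      simpa [inner_zero_right] using X.inner_self_nonneg η
    have := hcon ∅ h3
    simp only [traceSum, Finset.sum_empty] at this
    linarith
  have h2 := ENNReal.toReal_mono ENNReal.ofReal_ne_top h1
  rw [ENNReal.toReal_ofReal'] at h2
  rcases max_cases ((X.inducedTrace τ a).toReal - ε) 0 with h | h <;> linarith

/-- Traciality exchanges the two families: `τ(⟨bη, ξ⟩⟨ξ, bη⟩) = τ(⟨bξ, η⟩⟨η, bξ⟩)`. Summing over `η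
∈ K` first then uses `∑ θ_{η,η} ≤ 1`. -/
theorem sum_re_inner_thetaSum_le {K : Finset X.carrier} (hK : X.IsSubunital K) {ι : Type*}
    (s : Finset ι) (ξ : ι → X.carrier) {b : A} (hb : star b = b) :
    ∑ η ∈ K, τ.re (X.inner (X.left b η) (X.thetaSum s ξ (X.left b η))) ≤
      X.traceSum τ s ξ (b * b) := by
  simp only [inner_thetaSum, map_sum]
  rw [Finset.sum_comm]
  refine Finset.sum_le_sum fun i _ => ?_
  have h1 : ∀ η, τ.re (X.inner (X.left b η) (ξ i) * X.inner (ξ i) (X.left b η)) =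
      τ.re (X.inner (X.left b (ξ i)) η * X.inner η (X.left b (ξ i))) := fun η => by
    rw [τ.re_mul_comm, X.inner_left b η, X.inner_left b (ξ i), hb]
  simp only [h1]
  rw [← map_sum, X.left_mul]
  nth_rw 3 [← hb]
  rw [← X.inner_left]
  refine τ.re_mono ((X.inner_thetaSum K id _ _).symm.trans_le ?_)
  exact isSubunital_iff.1 hK _

/-- A family whose rank one sum nearly fixes the vectors `bη` has almost as large a trace at `b²` as
`K`. Hence any approximate unit computes the induced trace. -/
theorem traceSum_le_traceSum_add {K : Finset X.carrier} (hK : X.IsSubunital K) {ι : Type*}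
    (s : Finset ι) (ξ : ι → X.carrier) {b : A} (hb : star b = b) {ε : ℝ}
    (h : ∀ η ∈ K, ‖X.left b η - X.thetaSum s ξ (X.left b η)‖ ≤ ε) :
    X.traceSum τ K id (b * b) ≤ X.traceSum τ s ξ (b * b) + (∑ η ∈ K, ‖X.left b η‖) * ε := by
  have h1 := sum_re_inner_thetaSum_le τ hK s ξ hb
  have h2 : X.traceSum τ K id (b * b) =
      ∑ η ∈ K, τ.re (X.inner (X.left b η) (X.thetaSum s ξ (X.left b η))) +
      ∑ η ∈ K, τ.re (X.inner (X.left b η) (X.left b η - X.thetaSum s ξ (X.left b η))) := by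
    rw [traceSum, ← Finset.sum_add_distrib]
    refine Finset.sum_congr rfl fun η _ => ?_
    rw [← map_add, ← X.inner_add, add_sub_cancel, X.inner_left, hb, ← X.left_mul, id]
  rw [h2, Finset.sum_mul]
  refine add_le_add h1 (Finset.sum_le_sum fun η hη => ?_)
  refine (τ.re_le_norm _).trans ((X.norm_inner_le _ _).trans ?_)
  exact mul_le_mul_of_nonneg_left (h η hη) (norm_nonneg _)

end CStarCorrespondence

/-! ### Induced traces along an approximate unit -/

namespace CStarCorrespondence

variable {A : Type v} [NonUnitalCStarAlgebra A] [PartialOrder A] [StarOrderedRing A]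
  (X : CStarCorrespondence.{v, w} A)

theorem continuous_inner : Continuous fun p : X.carrier × X.carrier => X.inner p.1 p.2 :=
  IsBoundedBilinearMap.continuous (𝕜 := ℝ)
    { add_left := fun x y z => X.inner_add_left x y z
      smul_left := fun c x y => X.inner_real_smul_left c x y
      add_right := fun x y z => X.inner_add x y z
      smul_right := fun c x y => X.inner_real_smul_right c x y
      bound := ⟨1, one_pos, fun x y => by rw [one_mul]; exact X.norm_inner_le x y⟩ }

/-- There is an approximate unit consisting of operators `∑_{ξ ∈ H} θ_{ξ,ξ} ≤ 1`. -/
theorem exists_approxUnit : ∃ H : Finset X.carrier × ℕ → Finset X.carrier,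
    (∀ i, X.IsSubunital (H i)) ∧
      ∀ η, Tendsto (fun i => X.thetaSum (H i) id η) atTop (𝓝 η) := by
  choose H hH hle using fun i : Finset X.carrier × ℕ =>
    X.exists_isSubunital_approx i.1 (ε := 1 / ((i.2 : ℝ) + 1)) (by positivity)
  refine ⟨H, hH, fun η => ?_⟩
  rw [tendsto_iff_norm_sub_tendsto_zero]
  have h1 : Tendsto (fun i : Finset X.carrier × ℕ => 1 / ((i.2 : ℝ) + 1)) atTop (𝓝 0) := by
    rw [← prod_atTop_atTop_eq]
    exact (tendsto_one_div_add_atTop_nhds_zero_nat (𝕜 := ℝ)).comp tendsto_snd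
  refine squeeze_zero' (.of_forall fun _ => norm_nonneg _) ?_ h1
  filter_upwards [eventually_ge_atTop (({η} : Finset X.carrier), 0)] with i hi
  rw [norm_sub_rev]
  exact hle i η (hi.1 (Finset.mem_singleton_self η))

variable {X}

theorem eventually_traceSum_le (τ : TracialState A) {I : Type*} {l : Filter I}
    {H : I → Finset X.carrier} (hH : ∀ η, Tendsto (fun i => X.thetaSum (H i) id η) l (𝓝 η))
    {K : Finset X.carrier} (hK : X.IsSubunital K) {a : A} (ha : 0 ≤ a) {ε : ℝ} (hε : 0 < ε) :
    ∀ᶠ i in l, X.traceSum τ K id a ≤ X.traceSum τ (H i) id a + ε := by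
  set b := CFC.sqrt a
  have hb : star b = b := (IsSelfAdjoint.of_nonneg (CFC.sqrt_nonneg a)).star_eq
  have hab : b * b = a := CFC.sqrt_mul_sqrt_self a ha
  set c := ∑ η ∈ K, ‖X.left b η‖
  have hc : 0 ≤ c := Finset.sum_nonneg fun _ _ => norm_nonneg _
  have hev : ∀ᶠ i in l, ∀ η ∈ K, ‖X.left b η - X.thetaSum (H i) id (X.left b η)‖ ≤ ε / (c + 1) := by
    refine (eventually_all_finset K).2 fun η _ => ?_
    have := (tendsto_const_nhds (x := X.left b η)).sub (hH (X.left b η))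
    rw [sub_self] at this
    exact ((tendsto_zero_iff_norm_tendsto_zero.1 this).eventually_le_const (by positivity))
  filter_upwards [hev] with i hi
  have h := traceSum_le_traceSum_add τ hK (H i) id hb hi
  rw [hab] at h
  refine h.trans (add_le_add_right ?_ _)
  rw [mul_div_assoc', div_le_iff₀ (by positivity)]
  nlinarith

end CStarCorrespondence

/-! ### Rank one sums on products of fibres -/

namespace ProductSystem

variable {M : Type u} [Monoid M] {A : Type v} [NonUnitalCStarAlgebra A] [PartialOrder A]
  [StarOrderedRing A] (X : ProductSystem.{u, v, w} M A) {p q r : M} (h : p * q = r)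

theorem mul_right_left (ξ : (X.fiber p).carrier) (a : A) (ζ : (X.fiber q).carrier) :
    X.mul h ((X.fiber p).right ξ a) ζ = X.mul h ξ ((X.fiber q).left a ζ) := by
  rw [← X.mul_unit, ← X.unit_mul, X.mul_assoc]

theorem left_mul (a : A) (ξ : (X.fiber p).carrier) (ζ : (X.fiber q).carrier) :
    (X.fiber r).left a (X.mul h ξ ζ) = X.mul h ((X.fiber p).left a ξ) ζ := by
  rw [← X.unit_mul, ← X.unit_mul, X.mul_assoc]

theorem norm_mul_le (ξ : (X.fiber p).carrier) (ζ : (X.fiber q).carrier) :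
    ‖X.mul h ξ ζ‖ ≤ ‖ξ‖ * ‖ζ‖ := by
  refine abs_le_of_sq_le_sq' ?_ (by positivity) |>.2
  rw [(X.fiber r).norm_sq, X.inner_mul]
  refine ((X.fiber q).norm_inner_le _ _).trans ?_
  have h1 := (X.fiber q).norm_left_le ((X.fiber p).inner ξ ξ) ζ
  rw [← (X.fiber p).norm_sq] at h1
  nlinarith [norm_nonneg ζ]

/-- The multiplication as a linear map on the algebraic tensor product. -/
def mulTensor : (X.fiber p).carrier ⊗[ℂ] (X.fiber q).carrier →ₗ[ℂ] (X.fiber r).carrier :=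
  TensorProduct.lift (X.mul h)

/-- The operator `η ⊗ ζ ↦ ⟨ξ, η⟩ ζ`, adjoint to the multiplication by `ξ`. -/
def mulAdj (q : M) (ξ : (X.fiber p).carrier) :
    (X.fiber p).carrier ⊗[ℂ] (X.fiber q).carrier →ₗ[ℂ] (X.fiber q).carrier :=
  TensorProduct.lift ((X.fiber q).left.comp ((X.fiber p).innerL ξ))

theorem mulTensor_tmul (ξ : (X.fiber p).carrier) (ζ : (X.fiber q).carrier) :
    X.mulTensor h (ξ ⊗ₜ ζ) = X.mul h ξ ζ := rfl

theorem mulAdj_tmul (ξ η : (X.fiber p).carrier) (ζ : (X.fiber q).carrier) :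
    X.mulAdj q ξ (η ⊗ₜ ζ) = (X.fiber q).left ((X.fiber p).inner ξ η) ζ := rfl

theorem denseRange_mulTensor (hp : p ≠ 1) : DenseRange (X.mulTensor h) := by
  refine (X.dense_mul h hp).mono ?_
  rw [← LinearMap.coe_range]
  refine Submodule.span_le.2 ?_
  rintro _ ⟨ξ, ζ, rfl⟩
  exact ⟨ξ ⊗ₜ ζ, rfl⟩

theorem inner_mul_mulTensor (ξ : (X.fiber p).carrier) (ζ : (X.fiber q).carrier)
    (t : (X.fiber p).carrier ⊗[ℂ] (X.fiber q).carrier) :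
    (X.fiber r).inner (X.mul h ξ ζ) (X.mulTensor h t) =
      (X.fiber q).inner ζ (X.mulAdj q ξ t) := by
  induction t using TensorProduct.induction_on with
  | zero => simp [CStarCorrespondence.inner_zero_right]
  | tmul η ζ' => rw [mulTensor_tmul, mulAdj_tmul, X.inner_mul]
  | add s t hs ht => rw [map_add, map_add, CStarCorrespondence.inner_add, hs, ht,
      CStarCorrespondence.inner_add]

theorem inner_mulTensor_rTensor {T : Module.End ℂ (X.fiber p).carrier}
    (hT : (X.fiber p).IsSymm T) (s t : (X.fiber p).carrier ⊗[ℂ] (X.fiber q).carrier) :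
    (X.fiber r).inner (X.mulTensor h (T.rTensor _ s)) (X.mulTensor h t) =
      (X.fiber r).inner (X.mulTensor h s) (X.mulTensor h (T.rTensor _ t)) := by
  induction s using TensorProduct.induction_on with
  | zero => simp [CStarCorrespondence.inner_zero_left]
  | add s s' hs hs' => simp only [map_add, CStarCorrespondence.inner_add_left, hs, hs']
  | tmul η ζ =>
    induction t using TensorProduct.induction_on with
    | zero => simp [CStarCorrespondence.inner_zero_right]
    | add t t' ht ht' => simp only [map_add, CStarCorrespondence.inner_add, ht, ht']
    | tmul η' ζ' =>
      simp only [LinearMap.rTensor_tmul, mulTensor_tmul, X.inner_mul, hT η η']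

theorem mulTensor_rTensor_thetaSum {ι : Type*} (s : Finset ι) (ξ : ι → (X.fiber p).carrier)
    (t : (X.fiber p).carrier ⊗[ℂ] (X.fiber q).carrier) :
    X.mulTensor h (((X.fiber p).thetaSum s ξ).rTensor _ t) =
      ∑ i ∈ s, X.mul h (ξ i) (X.mulAdj q (ξ i) t) := by
  induction t using TensorProduct.induction_on with
  | zero => simp
  | add t t' ht ht' => simp only [map_add, ht, ht', Finset.sum_add_distrib]
  | tmul η ζ =>
    simp only [LinearMap.rTensor_tmul, mulTensor_tmul, CStarCorrespondence.thetaSum_apply,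
      map_sum, LinearMap.sum_apply, mul_right_left, mulAdj_tmul]

theorem inner_mulTensor_rTensor_thetaSum {ι : Type*} (s : Finset ι)
    (ξ : ι → (X.fiber p).carrier) (t : (X.fiber p).carrier ⊗[ℂ] (X.fiber q).carrier) :
    (X.fiber r).inner (X.mulTensor h t)
      (X.mulTensor h (((X.fiber p).thetaSum s ξ).rTensor _ t)) =
      ∑ i ∈ s, (X.fiber q).inner (X.mulAdj q (ξ i) t) (X.mulAdj q (ξ i) t) := by
  rw [mulTensor_rTensor_thetaSum, CStarCorrespondence.inner_sum_right]
  refine Finset.sum_congr rfl fun i _ => ?_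
  rw [← (X.fiber r).star_inner, inner_mul_mulTensor, (X.fiber q).star_inner]

/-- This is `T ⊗ 1 ≤ 1`. Positivity of `T ⊗ 1` is explicit as a sum of squares. For `U = 1 - T`, the
forms of `T^n U T^n ⊗ 1` decrease in `n` and tend to zero, so the form of `U ⊗ 1` is nonnegative. -/
theorem inner_mulTensor_thetaSum_le {ι : Type*} {s : Finset ι} {ξ : ι → (X.fiber p).carrier}
    (hP : (X.fiber p).IsPosContr ((X.fiber p).thetaSum s ξ))
    (t : (X.fiber p).carrier ⊗[ℂ] (X.fiber q).carrier) :
    (X.fiber r).inner (X.mulTensor h t)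
      (X.mulTensor h (((X.fiber p).thetaSum s ξ).rTensor _ t)) ≤
      (X.fiber r).inner (X.mulTensor h t) (X.mulTensor h t) := by
  have hpos : ∀ t, 0 ≤ (X.fiber r).inner (X.mulTensor h t)
      (X.mulTensor h (((X.fiber p).thetaSum s ξ).rTensor _ t)) := fun t => by
    rw [inner_mulTensor_rTensor_thetaSum]
    exact Finset.sum_nonneg fun i _ => (X.fiber q).inner_self_nonneg _
  set T := (X.fiber p).thetaSum s ξ
  have hU : ∀ t, ((1 - T).rTensor (X.fiber q).carrier) t = t - T.rTensor _ t := fun t => by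
    rw [LinearMap.rTensor_sub, LinearMap.sub_apply, Module.End.one_eq_id, LinearMap.rTensor_id,
      LinearMap.id_apply]
  -- Again `U - TUT = U² + UTU`, now tensored with `1`.
  have hstep : ∀ t, (X.fiber r).inner (X.mulTensor h (T.rTensor _ t))
        (X.mulTensor h ((1 - T).rTensor _ (T.rTensor _ t))) ≤
      (X.fiber r).inner (X.mulTensor h t) (X.mulTensor h ((1 - T).rTensor _ t)) := fun t => by
    have h1 := (X.fiber r).inner_self_nonneg (X.mulTensor h ((1 - T).rTensor _ t))
    have h2 := hpos ((1 - T).rTensor _ t)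
    have h3 := add_nonneg h1 h2
    have h4 := X.inner_mulTensor_rTensor h hP.symm t t
    rw [← sub_nonneg]
    simp only [hU, map_sub, CStarCorrespondence.inner_sub_left,
      CStarCorrespondence.inner_sub_right, h4] at h3 ⊢
    convert h3 using 1
    rw [X.inner_mulTensor_rTensor h hP.symm t (T.rTensor _ t)]
    abel
  have hiter : ∀ n : ℕ, (X.fiber r).inner (X.mulTensor h t)
      (X.mulTensor h ((T ^ n * (1 - T) * T ^ n).rTensor _ t)) ≤
      (X.fiber r).inner (X.mulTensor h t) (X.mulTensor h ((1 - T).rTensor _ t)) := by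
    intro n
    have hn : (X.fiber r).inner (X.mulTensor h t)
        (X.mulTensor h ((T ^ n * (1 - T) * T ^ n).rTensor _ t)) =
        (X.fiber r).inner (X.mulTensor h ((T ^ n).rTensor _ t))
        (X.mulTensor h ((1 - T).rTensor _ ((T ^ n).rTensor _ t))) := by
      rw [X.inner_mulTensor_rTensor h (hP.symm.pow n), LinearMap.rTensor_mul,
        LinearMap.rTensor_mul]
      rfl
    rw [hn]
    clear hn
    induction n with
    | zero => simp [Module.End.one_eq_id]
    | succ n ih =>
      refine le_trans ?_ ih
      rw [pow_succ', LinearMap.rTensor_mul, Module.End.mul_apply]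
      exact hstep _
  have hlim : Tendsto (fun n : ℕ => X.mulTensor h ((T ^ n * (1 - T) * T ^ n).rTensor _ t))
      atTop (𝓝 0) := by
    clear hiter
    induction t using TensorProduct.induction_on with
    | zero => simp
    | add t t' ht ht' => simpa only [map_add, add_zero] using ht.add ht'
    | tmul η ζ =>
      refine squeeze_zero_norm (fun n => ?_)
        (a := fun n => ‖(T ^ n * (1 - T) * T ^ n) η‖ * ‖ζ‖) ?_
      · rw [LinearMap.rTensor_tmul, mulTensor_tmul]
        exact X.norm_mul_le h _ _
      · simpa using (hP.tendsto_pow_mul_pow η).norm.mul_const ‖ζ‖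
  have hlim2 : Tendsto (fun n : ℕ => (X.fiber r).inner (X.mulTensor h t)
      (X.mulTensor h ((T ^ n * (1 - T) * T ^ n).rTensor _ t))) atTop (𝓝 0) := by
    have := ((X.fiber r).continuous_inner.comp
      (Continuous.prodMk_right (X.mulTensor h t))).continuousAt.tendsto.comp hlim
    simpa [Function.comp_def, CStarCorrespondence.inner_zero_right] using this
  have := le_of_tendsto' hlim2 hiter
  rwa [hU, map_sub, CStarCorrespondence.inner_sub_right, sub_nonneg] at this

/-- Products of members of subunital families form a subunital family. -/
theorem inner_thetaSum_sigma_le (hp : p ≠ 1) {H : Finset (X.fiber p).carrier}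
    (hH : (X.fiber p).IsSubunital H)
    {H' : (X.fiber p).carrier → Finset (X.fiber q).carrier}
    (hH' : ∀ ξ, (X.fiber q).IsSubunital (H' ξ)) (x : (X.fiber r).carrier) :
    (X.fiber r).inner x ((X.fiber r).thetaSum (H.sigma H') (fun y => X.mul h y.1 y.2) x) ≤
      (X.fiber r).inner x x := by
  refine (X.denseRange_mulTensor h hp).induction_on
    (p := fun x => (X.fiber r).inner x ((X.fiber r).thetaSum (H.sigma H')
      (fun y => X.mul h y.1 y.2) x) ≤ (X.fiber r).inner x x) x ?_ fun t => ?_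
  · refine isClosed_le ?_ ((X.fiber r).continuous_inner.comp (continuous_id.prodMk continuous_id))
    simp only [CStarCorrespondence.inner_thetaSum]
    refine continuous_finsetSum _ fun y _ => ?_
    exact ((X.fiber r).continuous_inner.comp (continuous_id.prodMk continuous_const)).mul
      ((X.fiber r).continuous_inner.comp (continuous_const.prodMk continuous_id))
  · refine le_trans ?_ (X.inner_mulTensor_thetaSum_le h hH.isPosContr t)
    rw [inner_mulTensor_rTensor_thetaSum, CStarCorrespondence.inner_thetaSum, Finset.sum_sigma]
    refine Finset.sum_le_sum fun ξ _ => ?_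
    refine le_trans (le_of_eq ?_)
      (CStarCorrespondence.isSubunital_iff.1 (hH' ξ) (X.mulAdj q ξ t))
    rw [CStarCorrespondence.inner_thetaSum]
    refine Finset.sum_congr rfl fun ζ _ => ?_
    rw [inner_mul_mulTensor, ← (X.fiber r).star_inner, inner_mul_mulTensor,
      (X.fiber q).star_inner]
    rfl

theorem traceSum_sigma (τ : TracialState A) (H : Finset (X.fiber p).carrier)
    (H' : (X.fiber p).carrier → Finset (X.fiber q).carrier) (a : A) :
    (X.fiber r).traceSum τ (H.sigma H') (fun y => X.mul h y.1 y.2) a =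
      ∑ ξ ∈ H, (X.fiber q).traceSum τ (H' ξ) id
        ((X.fiber p).inner ξ ((X.fiber p).left a ξ)) := by
  simp only [CStarCorrespondence.traceSum, Finset.sum_sigma, left_mul, X.inner_mul, id]

theorem tendsto_mulTensor_rTensor {I : Type*} {l : Filter I}
    {H : I → Finset (X.fiber p).carrier}
    (hH : ∀ η, Tendsto (fun i => (X.fiber p).thetaSum (H i) id η) l (𝓝 η))
    (t : (X.fiber p).carrier ⊗[ℂ] (X.fiber q).carrier) :
    Tendsto (fun i => X.mulTensor h (((X.fiber p).thetaSum (H i) id).rTensor _ t)) l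
      (𝓝 (X.mulTensor h t)) := by
  induction t using TensorProduct.induction_on with
  | zero => simpa using tendsto_const_nhds
  | add t t' ht ht' => simpa only [map_add] using ht.add ht'
  | tmul η ζ =>
    simp only [LinearMap.rTensor_tmul, mulTensor_tmul]
    rw [tendsto_iff_norm_sub_tendsto_zero]
    have h1 := (tendsto_iff_norm_sub_tendsto_zero.1 (hH η)).mul_const ‖ζ‖
    rw [zero_mul] at h1
    refine squeeze_zero (fun _ => norm_nonneg _) (fun i => ?_) h1
    rw [← LinearMap.sub_apply, ← map_sub]
    exact X.norm_mul_le h _ _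

/-- For fixed `H`, letting `H'` run through an approximate unit of `X_q` recovers `∑_{ξ ∈ H} θ_{ξ,ξ}
⊗ 1`. -/
theorem tendsto_thetaSum_sigma_mulTensor {I : Type*} {l : Filter I}
    (H : Finset (X.fiber p).carrier) {H' : I → Finset (X.fiber q).carrier}
    (hH' : ∀ η, Tendsto (fun i => (X.fiber q).thetaSum (H' i) id η) l (𝓝 η))
    (t : (X.fiber p).carrier ⊗[ℂ] (X.fiber q).carrier) :
    Tendsto (fun i => (X.fiber r).thetaSum (H.sigma fun _ => H' i)
      (fun y => X.mul h y.1 y.2) (X.mulTensor h t)) l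
      (𝓝 (X.mulTensor h (((X.fiber p).thetaSum H id).rTensor _ t))) := by
  have he : ∀ i, (X.fiber r).thetaSum (H.sigma fun _ => H' i)
      (fun y => X.mul h y.1 y.2) (X.mulTensor h t) =
      ∑ ξ ∈ H, X.mul h ξ ((X.fiber q).thetaSum (H' i) id (X.mulAdj q ξ t)) := fun i => by
    rw [CStarCorrespondence.thetaSum_apply, Finset.sum_sigma]
    refine Finset.sum_congr rfl fun ξ _ => ?_
    rw [CStarCorrespondence.thetaSum_apply, map_sum]
    refine Finset.sum_congr rfl fun ζ _ => ?_
    rw [inner_mul_mulTensor, ← X.mul_unit, ← X.mul_unit, X.mul_assoc h (mul_one r) (mul_one q) h]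
    rfl
  simp only [he, mulTensor_rTensor_thetaSum]
  refine tendsto_finsetSum _ fun ξ _ => ?_
  rw [tendsto_iff_norm_sub_tendsto_zero]
  have h1 := (tendsto_iff_norm_sub_tendsto_zero.1 (hH' (X.mulAdj q ξ t))).const_mul ‖ξ‖
  rw [mul_zero] at h1
  refine squeeze_zero (fun _ => norm_nonneg _) (fun i => ?_) h1
  rw [id, ← map_sub]
  exact X.norm_mul_le h _ _

end ProductSystem

/-! ### Multiplicativity of induced traces -/

namespace ProductSystem

variable {M : Type u} [Monoid M] {A : Type v} [NonUnitalCStarAlgebra A] [PartialOrder A]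
  [StarOrderedRing A] (X : ProductSystem.{u, v, w} M A) {p q r : M}

/-- An iterated limit: first `H i` is taken far enough, then `H'` depending on `i`. One `H'` serves
every `ξ ∈ H i`. -/
theorem eventually_exists_norm_sub_le (h : p * q = r) (hp : p ≠ 1) {I : Type*} {l : Filter I}
    {H : I → Finset (X.fiber p).carrier} (hHs : ∀ i, (X.fiber p).IsSubunital (H i))
    (hH : ∀ η, Tendsto (fun i => (X.fiber p).thetaSum (H i) id η) l (𝓝 η))
    (K : Finset (X.fiber r).carrier) {ε : ℝ} (hε : 0 < ε) :
    ∀ᶠ i in l, ∃ H' : Finset (X.fiber q).carrier, (X.fiber q).IsSubunital H' ∧ ∀ x ∈ K,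
      ‖x - (X.fiber r).thetaSum ((H i).sigma fun _ => H') (fun y => X.mul h y.1 y.2) x‖ ≤ ε := by
  classical
  obtain ⟨H', hHs', hH'⟩ := (X.fiber q).exists_approxUnit
  suffices hs : ∀ᶠ i in l, ∀ x ∈ K, ∀ᶠ j in atTop, ‖x - (X.fiber r).thetaSum
      ((H i).sigma fun _ => H' j) (fun y => X.mul h y.1 y.2) x‖ ≤ ε by
    filter_upwards [hs] with i hi
    obtain ⟨j, hj⟩ := ((eventually_all_finset K).2 hi).exists
    exact ⟨H' j, hHs' j, hj⟩
  refine (eventually_all_finset K).2 fun x _ => ?_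
  -- It suffices to approximate on the dense image of the tensor product, because the operator `W`
  -- below is a contraction. The four differences in `e` each cost `ε/4`.
  obtain ⟨t, ht⟩ := (X.denseRange_mulTensor h hp).exists_dist_lt x (show 0 < ε / 4 by linarith)
  rw [dist_eq_norm] at ht
  have h1 := (tendsto_iff_norm_sub_tendsto_zero.1
    (X.tendsto_mulTensor_rTensor h hH t)).eventually_le_const (show 0 < ε / 4 by linarith)
  filter_upwards [h1] with i hi
  have h2 := (tendsto_iff_norm_sub_tendsto_zero.1
    (X.tendsto_thetaSum_sigma_mulTensor h (H i) hH' t)).eventually_le_const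
      (show 0 < ε / 4 by linarith)
  filter_upwards [h2] with j hj
  have hW := CStarCorrespondence.isPosContr_thetaSum
    (X.inner_thetaSum_sigma_le h hp (hHs i) (fun _ => hHs' j))
  set W := (X.fiber r).thetaSum ((H i).sigma fun _ => H' j) (fun y => X.mul h y.1 y.2)
  have h3 := hW.norm_apply_le (x - X.mulTensor h t)
  rw [map_sub] at h3
  rw [norm_sub_rev] at hi hj h3
  set y := X.mulTensor h t
  have e : x - W x = (x - y) + (y - X.mulTensor h
      (((X.fiber p).thetaSum (H i) id).rTensor _ t)) +
      (X.mulTensor h (((X.fiber p).thetaSum (H i) id).rTensor _ t) - W y) + (W y - W x) := by abel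
  rw [e]
  have n1 := norm_add_le ((x - y) + (y - X.mulTensor h
      (((X.fiber p).thetaSum (H i) id).rTensor _ t)) +
      (X.mulTensor h (((X.fiber p).thetaSum (H i) id).rTensor _ t) - W y)) (W y - W x)
  have n2 := norm_add₃_le (a := x - y) (b := y - X.mulTensor h
      (((X.fiber p).thetaSum (H i) id).rTensor _ t))
      (c := X.mulTensor h (((X.fiber p).thetaSum (H i) id).rTensor _ t) - W y)
  linarith

theorem eventually_exists_traceSum_le (h : p * q = r) (hp : p ≠ 1) (τ : TracialState A) {I : Type*}
    {l : Filter I}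
    {H : I → Finset (X.fiber p).carrier} (hHs : ∀ i, (X.fiber p).IsSubunital (H i))
    (hH : ∀ η, Tendsto (fun i => (X.fiber p).thetaSum (H i) id η) l (𝓝 η))
    {K : Finset (X.fiber r).carrier} (hK : (X.fiber r).IsSubunital K) {a : A} (ha : 0 ≤ a)
    {ε : ℝ} (hε : 0 < ε) :
    ∀ᶠ i in l, ∃ H' : Finset (X.fiber q).carrier, (X.fiber q).IsSubunital H' ∧
      (X.fiber r).traceSum τ K id a ≤ ∑ ξ ∈ H i, (X.fiber q).traceSum τ H' id
        ((X.fiber p).inner ξ ((X.fiber p).left a ξ)) + ε := by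
  set b := CFC.sqrt a
  have hb : star b = b := (IsSelfAdjoint.of_nonneg (CFC.sqrt_nonneg a)).star_eq
  have hab : b * b = a := CFC.sqrt_mul_sqrt_self a ha
  set c := ∑ η ∈ K, ‖(X.fiber r).left b η‖
  have hc : 0 ≤ c := Finset.sum_nonneg fun _ _ => norm_nonneg _
  classical
  have hev := X.eventually_exists_norm_sub_le h hp hHs hH (K.image ((X.fiber r).left b))
    (show 0 < ε / (c + 1) by positivity)
  filter_upwards [hev] with i ⟨H', hH's, hi⟩
  refine ⟨H', hH's, ?_⟩
  have h1 := CStarCorrespondence.traceSum_le_traceSum_add τ hK _ _ hb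
    fun η hη => hi _ (Finset.mem_image_of_mem _ hη)
  rw [hab, traceSum_sigma] at h1
  refine h1.trans (add_le_add_right ?_ _)
  rw [mul_div_assoc', div_le_iff₀ (by positivity)]
  nlinarith

/-- The traces induced through the fibres are finite on the positive cone. -/
def HasFiniteTrace (τ : TracialState A) (p : M) : Prop :=
  ∀ a : A, 0 ≤ a → (X.fiber p).inducedTrace τ a ≠ ⊤

theorem traceSum_le_toReal {τ : TracialState A} (hf : X.HasFiniteTrace τ p)
    {K : Finset (X.fiber p).carrier} (hK : (X.fiber p).IsSubunital K) {a : A} (ha : 0 ≤ a) :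
    (X.fiber p).traceSum τ K id a ≤ ((X.fiber p).inducedTrace τ a).toReal :=
  (ENNReal.ofReal_le_iff_le_toReal (hf a ha)).1
    (CStarCorrespondence.traceSum_le_inducedTrace τ
      (CStarCorrespondence.isSubunital_iff.1 hK) a)

theorem exists_inducedTrace_mul_le (h : p * q = r) (hp : p ≠ 1) (τ : TracialState A) {C D : ℝ} (hC : 0 ≤ C)
    (hpC : ∀ a, 0 ≤ a → (X.fiber p).inducedTrace τ a ≤ ENNReal.ofReal (D * τ.re a))
    (hqC : ∀ a, 0 ≤ a → (X.fiber q).inducedTrace τ a ≤ ENNReal.ofReal (C * τ.re a))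
    (hD : 0 ≤ D) {a : A} (ha : 0 ≤ a) :
    (X.fiber r).inducedTrace τ a ≤ ENNReal.ofReal (C * D * τ.re a) := by
  classical
  obtain ⟨H, hHs, hH⟩ := (X.fiber p).exists_approxUnit
  have hre := τ.re_nonneg ha
  refine CStarCorrespondence.inducedTrace_le τ fun K hK => ENNReal.ofReal_le_ofReal ?_
  refine le_of_forall_pos_le_add fun ε hε => ?_
  obtain ⟨i, H', hH', hi⟩ :=
    (X.eventually_exists_traceSum_le h hp τ hHs hH hK ha hε).exists
  refine hi.trans (add_le_add_left ?_ _)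
  have h1 : ∀ ξ ∈ H i, (X.fiber q).traceSum τ H' id
      ((X.fiber p).inner ξ ((X.fiber p).left a ξ)) ≤
      C * τ.re ((X.fiber p).inner ξ ((X.fiber p).left a ξ)) := fun ξ _ => by
    have hn := (X.fiber p).inner_left_nonneg ha ξ
    rw [← ENNReal.ofReal_le_ofReal_iff (mul_nonneg hC (τ.re_nonneg hn))]
    exact (CStarCorrespondence.traceSum_le_inducedTrace τ
      (CStarCorrespondence.isSubunital_iff.1 hH') _).trans (hqC _ hn)
  refine (Finset.sum_le_sum h1).trans ?_
  rw [← Finset.mul_sum, _root_.mul_assoc]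
  refine mul_le_mul_of_nonneg_left ?_ hC
  rw [← ENNReal.ofReal_le_ofReal_iff (mul_nonneg hD hre)]
  exact (CStarCorrespondence.traceSum_le_inducedTrace τ (s := H i) (ξ := id)
      (CStarCorrespondence.isSubunital_iff.1 (hHs i)) _).trans (hpC _ ha)

/-- Choose a nearly optimal subunital family in `X_q` for each `ξ ∈ H`; the products form a
subunital family in `X_r`. -/
theorem sum_inducedTrace_le (h : p * q = r) (hp : p ≠ 1) {τ : TracialState A}
    (hr : X.HasFiniteTrace τ r) {H : Finset (X.fiber p).carrier}
    (hH : (X.fiber p).IsSubunital H) {a : A} (ha : 0 ≤ a) :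
    ∑ ξ ∈ H, ((X.fiber q).inducedTrace τ
      ((X.fiber p).inner ξ ((X.fiber p).left a ξ))).toReal ≤
      ((X.fiber r).inducedTrace τ a).toReal := by
  refine le_of_forall_pos_le_add fun ε hε => ?_
  choose H' hH' hle using fun ξ : (X.fiber p).carrier =>
    CStarCorrespondence.exists_le_traceSum_add (X := X.fiber q) τ
      ((X.fiber p).inner ξ ((X.fiber p).left a ξ))
      (show 0 < ε / (H.card + 1) by positivity)
  have h1 := CStarCorrespondence.traceSum_le_inducedTrace τ
    (X.inner_thetaSum_sigma_le h hp hH hH') a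
  rw [ENNReal.ofReal_le_iff_le_toReal (hr a ha), traceSum_sigma] at h1
  refine (Finset.sum_le_sum fun ξ _ => hle ξ).trans ?_
  rw [Finset.sum_add_distrib, Finset.sum_const, nsmul_eq_mul]
  refine add_le_add h1 ?_
  rw [mul_div_assoc', div_le_iff₀ (by positivity)]
  nlinarith

open Classical in
/-- The functional `τ` for `p = 1` and the trace induced through `X_p` for `p ≠ 1`. -/
noncomputable def fiberTrace (τ : TracialState A) (p : M) (a : A) : ℝ :=
  if p = 1 then τ.re a else ((X.fiber p).inducedTrace τ a).toReal

/-- The upper bound holds for every `i`; the lower bound holds eventually, by comparison with a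
nearly optimal family in `X_r`. For `q = 1` the sums are those defining the trace through `X_p`. -/
theorem tendsto_sum_fiberTrace (h : p * q = r) (hp : p ≠ 1) (hr1 : r ≠ 1) {τ : TracialState A}
    (hq : q ≠ 1 → X.HasFiniteTrace τ q) (hr : X.HasFiniteTrace τ r) {I : Type*} {l : Filter I}
    {H : I → Finset (X.fiber p).carrier} (hHs : ∀ i, (X.fiber p).IsSubunital (H i))
    (hH : ∀ η, Tendsto (fun i => (X.fiber p).thetaSum (H i) id η) l (𝓝 η))
    {a : A} (ha : 0 ≤ a) :
    Tendsto (fun i => ∑ ξ ∈ H i,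
      X.fiberTrace τ q ((X.fiber p).inner ξ ((X.fiber p).left a ξ))) l
      (𝓝 (X.fiberTrace τ r a)) := by
  have key : ∀ ε > 0, ∀ᶠ i in l,
      X.fiberTrace τ r a ≤ ∑ ξ ∈ H i,
        X.fiberTrace τ q ((X.fiber p).inner ξ ((X.fiber p).left a ξ)) + ε := by
    intro ε hε
    obtain ⟨K, hK, hKle⟩ := CStarCorrespondence.exists_le_traceSum_add (X := X.fiber r) τ a
      (half_pos hε)
    rw [fiberTrace, if_neg hr1]
    by_cases hq1 : q = 1
    · subst hq1
      obtain rfl : p = r := by rw [← h, mul_one]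
      filter_upwards [CStarCorrespondence.eventually_traceSum_le τ hH hK ha (half_pos hε)]
        with i hi
      simp only [fiberTrace, if_true]
      simp only [CStarCorrespondence.traceSum, id] at hi hKle
      linarith
    · filter_upwards [X.eventually_exists_traceSum_le h hp τ hHs hH hK ha (half_pos hε)]
        with i ⟨H', hH', hi⟩
      simp only [fiberTrace, if_neg hq1]
      have := Finset.sum_le_sum fun ξ (_ : ξ ∈ H i) => X.traceSum_le_toReal (hq hq1) hH'
        ((X.fiber p).inner_left_nonneg ha ξ)
      linarith
  have upper : ∀ i, ∑ ξ ∈ H i,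
      X.fiberTrace τ q ((X.fiber p).inner ξ ((X.fiber p).left a ξ)) ≤ X.fiberTrace τ r a := by
    intro i
    simp only [fiberTrace, if_neg hr1]
    split_ifs with hq1
    · subst hq1
      obtain rfl : p = r := by rw [← h, mul_one]
      exact X.traceSum_le_toReal hr (hHs i) ha
    · exact X.sum_inducedTrace_le h hp hr (hHs i) ha
  rw [Metric.tendsto_nhds]
  intro ε hε
  filter_upwards [key (ε / 2) (half_pos hε)] with i hi
  rw [Real.dist_eq, abs_lt]
  constructor <;> linarith [upper i]

end ProductSystem

/-! ### Inclusion-exclusion for principal right ideals -/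

section Combinatorics

variable {M : Type u} [Monoid M]

theorem mem_principalRightIdeal {p x : M} : x ∈ principalRightIdeal p ↔ p ∣ x :=
  ⟨fun ⟨y, hy⟩ => ⟨y, hy.symm⟩, fun ⟨y, hy⟩ => ⟨y, hy.symm⟩⟩

theorem principalRightIdeal_one : principalRightIdeal (1 : M) = Set.univ :=
  Set.eq_univ_of_forall fun x => mem_principalRightIdeal.2 (one_dvd x)

theorem omega_empty : Omega (∅ : Finset M) = Set.univ := by simp [Omega]

theorem mem_omega {K : Finset M} {x : M} : x ∈ Omega K ↔ ∀ k ∈ K, ¬ k ∣ x := by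
  simp [Omega, mem_principalRightIdeal]

theorem image_mul_omega_empty (p : M) :
    (fun x => p * x) '' Omega (∅ : Finset M) = principalRightIdeal p := by
  rw [omega_empty, Set.image_univ]; rfl

theorem principalRightIdeal_mem_finiteDisjointUnions (R : Set M) (p : M) :
    principalRightIdeal p ∈ finiteDisjointUnions R :=
  ⟨1, fun _ => p, fun _ => ∅, by simp, fun i j hij => absurd (Subsingleton.elim i j) hij, by
    simp only [image_mul_omega_empty, Set.iUnion_const]⟩

theorem image_mul_omega [IsLeftCancelMul M] (p : M) (K : Finset M) :
    (fun x => p * x) '' Omega K =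
      principalRightIdeal p \ ⋃ k ∈ K, principalRightIdeal (p * k) := by
  ext x
  simp only [Set.mem_image, Set.mem_sdiff, Set.mem_iUnion, mem_principalRightIdeal, mem_omega,
    not_exists]
  constructor
  · rintro ⟨y, hy, rfl⟩
    exact ⟨dvd_mul_right _ _, fun k hk ⟨z, hz⟩ =>
      hy k hk ⟨z, mul_left_cancel (hz.trans (mul_assoc _ _ _))⟩⟩
  · rintro ⟨⟨y, rfl⟩, hy⟩
    exact ⟨y, fun k hk ⟨z, hz⟩ => hy k hk ⟨z, by rw [hz, mul_assoc]⟩, rfl⟩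

theorem finiteDisjointUnions_eq_idealAlgebra [IsLeftCancelMul M] {R : Set M}
    (hR : MeasureTheory.IsSetAlgebra (finiteDisjointUnions R)) :
    finiteDisjointUnions R = idealAlgebra M := by
  have hB : MeasureTheory.IsSetAlgebra (idealAlgebra M) :=
    MeasureTheory.isSetAlgebra_generateSetAlgebra
  have hmem : ∀ p : M, principalRightIdeal p ∈ idealAlgebra M := fun p =>
    MeasureTheory.self_subset_generateSetAlgebra ⟨p, rfl⟩
  refine Set.Subset.antisymm ?_ ?_
  · rintro _ ⟨n, p, K, -, -, rfl⟩
    have := hB.biUnion_mem (s := fun j : Fin n => (fun x => p j * x) '' Omega (K j))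
      Finset.univ fun j _ => by
        rw [image_mul_omega]
        exact hB.sdiff_mem (hmem _) (hB.biUnion_mem (K j) fun k _ => hmem _)
    simpa using this
  · refine hR.generateSetAlgebra_subset ?_
    rintro _ ⟨p, rfl⟩
    exact principalRightIdeal_mem_finiteDisjointUnions R p

theorem omega_mem_of_isSetAlgebra {R : Set M}
    (hR : MeasureTheory.IsSetAlgebra (finiteDisjointUnions R)) (J : Finset M) :
    Omega J ∈ finiteDisjointUnions R := by
  by_cases hJ : J.Nonempty
  · exact hR.biInter_mem J fun k _ =>
      hR.compl_mem (principalRightIdeal_mem_finiteDisjointUnions R k)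
  · rw [Finset.not_nonempty_iff_eq_empty.1 hJ, omega_empty, ← principalRightIdeal_one]
    exact principalRightIdeal_mem_finiteDisjointUnions R 1

theorem exists_isRightLCM_of_forall_dvd
    (hlcm : ∀ p q x : M, p ∣ x → q ∣ x → ∃ r, IsRightLCM {p, q} r) (K : Finset M) {x : M}
    (hx : ∀ k ∈ K, k ∣ x) : ∃ r, IsRightLCM (K : Set M) r := by
  classical
  induction K using Finset.induction_on with
  | empty => exact ⟨1, by simp [IsRightLCM]⟩
  | insert k K hk ih =>
    obtain ⟨s, hs1, hs2⟩ := ih fun k hk => hx k (Finset.mem_insert_of_mem hk)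
    obtain ⟨r, hr1, hr2⟩ := hlcm k s x (hx k (Finset.mem_insert_self _ _))
      (hs2 x fun k hk => hx k (Finset.mem_insert_of_mem hk))
    refine ⟨r, fun p hp => ?_, fun r' hr' => hr2 r' ?_⟩
    · rcases Finset.mem_insert.1 hp with rfl | hp
      · exact hr1 _ (by simp)
      · exact (hs1 p hp).trans (hr1 s (by simp))
    · rintro p (rfl | rfl)
      · exact hr' _ (by simp)
      · exact hs2 r' fun p hp => hr' p (Finset.mem_insert_of_mem hp)

/-- The indicator functions of the sets `pM` are linearly independent. -/
theorem linearIndependent_indicator_principalRightIdeal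
    (hanti : ∀ p q : M, p ∣ q → q ∣ p → p = q) :
    LinearIndependent ℝ fun p : M => (principalRightIdeal p).indicator (1 : M → ℝ) := by
  classical
  rw [linearIndependent_iff']
  intro s g hg
  by_contra! hne
  obtain ⟨p₀, hp₀⟩ := hne
  -- A member of the support with the fewest divisors in the support is minimal for divisibility. At
  -- the point `p` only the term of `p` itself survives.
  obtain ⟨p, hp, hmin⟩ := (s.filter fun i => g i ≠ 0).exists_min_image
    (fun p => ((s.filter fun i => g i ≠ 0).filter fun q => q ∣ p).card)
    ⟨p₀, Finset.mem_filter.2 hp₀⟩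
  obtain ⟨hps, hp0⟩ := Finset.mem_filter.1 hp
  have h := congrFun hg p
  rw [Finset.sum_apply, Finset.sum_eq_single_of_mem p hps] at h
  · rw [Pi.smul_apply, Set.indicator_of_mem (mem_principalRightIdeal.2 dvd_rfl), Pi.one_apply,
      smul_eq_mul, mul_one] at h
    exact hp0 h
  · intro q hq hqp
    rw [Pi.smul_apply]
    by_cases hgq : g q = 0
    · rw [hgq, zero_smul]
    · rw [Set.indicator_of_notMem, smul_zero]
      intro hmem
      rw [mem_principalRightIdeal] at hmem
      have hqF : q ∈ s.filter fun i => g i ≠ 0 := Finset.mem_filter.2 ⟨hq, hgq⟩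
      refine (Finset.card_lt_card ?_).not_ge (hmin q hqF)
      refine Finset.ssubset_iff_of_subset (fun x hx => ?_) |>.2
        ⟨p, Finset.mem_filter.2 ⟨hp, dvd_rfl⟩, fun hx => ?_⟩
      · obtain ⟨hx1, hx2⟩ := Finset.mem_filter.1 hx
        exact Finset.mem_filter.2 ⟨hx1, hx2.trans hmem⟩
      · exact hqp (hanti q p hmem (Finset.mem_filter.1 hx).2)

/-- The function `∑ v_p 1_{pM}` on `M`. -/
noncomputable def indicatorSum : (M →₀ ℝ) →ₗ[ℝ] M → ℝ :=
  Finsupp.linearCombination ℝ fun p : M => (principalRightIdeal p).indicator (1 : M → ℝ)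

open Classical in
/-- The formal sum `∑_{K ⊆ J} (-1)^{|K|} [∨K]`. -/
noncomputable def omegaSum (J : Finset M) : M →₀ ℝ :=
  ∑ K ∈ J.powerset, if h : ∃ r : M, IsRightLCM (K : Set M) r then
    Finsupp.single h.choose ((-1) ^ K.card) else 0

theorem indicatorSum_single (p : M) (c : ℝ) :
    indicatorSum (Finsupp.single p c) = c • (principalRightIdeal p).indicator 1 :=
  Finsupp.linearCombination_single ..

/-- At a point `y`, exactly the `K ⊆ J` all of whose members divide `y` contribute, and for those
`∨K` exists. The alternating sum over the subsets of `{k ∈ J : k ∣ y}` vanishes unless this set is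
empty, that is, `y ∈ Ω_J`. -/
theorem indicatorSum_omegaSum
    (hlcm : ∀ p q x : M, p ∣ x → q ∣ x → ∃ r, IsRightLCM {p, q} r) (J : Finset M) :
    indicatorSum (omegaSum J) = (Omega J).indicator 1 := by
  classical
  funext y
  have hterm : ∀ K ∈ J.powerset, indicatorSum (if h : ∃ r : M, IsRightLCM (K : Set M) r then
      Finsupp.single h.choose ((-1 : ℝ) ^ K.card) else 0) y =
      if K ⊆ J.filter (· ∣ y) then (-1 : ℝ) ^ K.card else 0 := by
    intro K hK
    have hiff : K ⊆ J.filter (· ∣ y) ↔ ∀ k ∈ K, k ∣ y :=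
      ⟨fun h k hk => (Finset.mem_filter.1 (h hk)).2, fun h k hk =>
        Finset.mem_filter.2 ⟨Finset.mem_powerset.1 hK hk, h k hk⟩⟩
    rw [if_congr hiff rfl rfl]
    split_ifs with h1 h2 h2
    · rw [indicatorSum_single, Pi.smul_apply, Set.indicator_of_mem]
      · simp
      · exact mem_principalRightIdeal.2 (h1.choose_spec.2 y h2)
    · rw [indicatorSum_single, Pi.smul_apply, Set.indicator_of_notMem, smul_zero]
      exact fun hm => h2 fun k hk =>
        (h1.choose_spec.1 k hk).trans (mem_principalRightIdeal.1 hm)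
    · exact absurd (exists_isRightLCM_of_forall_dvd hlcm K h2) h1
    · simp
  rw [omegaSum, map_sum, Finset.sum_apply, Finset.sum_congr rfl hterm, ← Finset.sum_filter]
  have hset : J.powerset.filter (· ⊆ J.filter (· ∣ y)) = (J.filter (· ∣ y)).powerset := by
    ext K
    simp only [Finset.mem_filter, Finset.mem_powerset]
    exact ⟨fun h => h.2, fun h => ⟨h.trans (Finset.filter_subset _ _), h⟩⟩
  rw [hset]
  have hsum := Finset.sum_powerset_neg_one_pow_card (x := J.filter (· ∣ y))
  have hsum' : ∑ K ∈ (J.filter (· ∣ y)).powerset, (-1 : ℝ) ^ K.card =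
      if J.filter (· ∣ y) = ∅ then 1 else 0 := by
    have := congrArg (Int.cast : ℤ → ℝ) hsum
    push_cast at this
    exact this
  rw [hsum']
  have hmem : J.filter (· ∣ y) = ∅ ↔ y ∈ Omega J := by
    rw [mem_omega, Finset.filter_eq_empty_iff]
  rw [if_congr hmem rfl rfl, Set.indicator_apply]
  rfl

theorem indicatorSum_lmapDomain [IsLeftCancelMul M] (p : M) (v : M →₀ ℝ) (y : M) :
    indicatorSum (Finsupp.lmapDomain ℝ ℝ (p * ·) v) (p * y) = indicatorSum v y := by
  classical
  induction v using Finsupp.induction_linear with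
  | zero => simp
  | add v w hv hw => rw [map_add, map_add, map_add, Pi.add_apply, Pi.add_apply, hv, hw]
  | single q c =>
    rw [Finsupp.lmapDomain_apply, Finsupp.mapDomain_single, indicatorSum_single,
      indicatorSum_single, Pi.smul_apply, Pi.smul_apply, Set.indicator_apply,
      Set.indicator_apply]
    have : p * y ∈ principalRightIdeal (p * q) ↔ y ∈ principalRightIdeal q := by
      rw [mem_principalRightIdeal, mem_principalRightIdeal]
      exact ⟨fun ⟨z, hz⟩ => ⟨z, mul_left_cancel (hz.trans (mul_assoc _ _ _))⟩,
        fun ⟨z, hz⟩ => ⟨z, by rw [hz, mul_assoc]⟩⟩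
    simp only [this]
    rfl

theorem indicatorSum_lmapDomain_of_not_dvd {p x : M} (hx : ¬ p ∣ x) (v : M →₀ ℝ) :
    indicatorSum (Finsupp.lmapDomain ℝ ℝ (p * ·) v) x = 0 := by
  induction v using Finsupp.induction_linear with
  | zero => simp
  | add v w hv hw => rw [map_add, map_add, Pi.add_apply, hv, hw, add_zero]
  | single q c =>
    rw [Finsupp.lmapDomain_apply, Finsupp.mapDomain_single, indicatorSum_single, Pi.smul_apply,
      Set.indicator_of_notMem, smul_zero]
    exact fun h => hx ((dvd_mul_right p q).trans (mem_principalRightIdeal.1 h))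

theorem indicatorSum_lmapDomain_omegaSum [IsLeftCancelMul M]
    (hlcm : ∀ p q x : M, p ∣ x → q ∣ x → ∃ r, IsRightLCM {p, q} r) (p : M) (K : Finset M) :
    indicatorSum (Finsupp.lmapDomain ℝ ℝ (p * ·) (omegaSum K)) =
      ((fun x => p * x) '' Omega K).indicator 1 := by
  classical
  funext x
  by_cases hx : p ∣ x
  · obtain ⟨y, rfl⟩ := hx
    rw [indicatorSum_lmapDomain, indicatorSum_omegaSum hlcm, Set.indicator_apply,
      Set.indicator_apply]
    have : (p * y ∈ (fun x => p * x) '' Omega K) ↔ y ∈ Omega K :=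
      (mul_right_injective p).mem_set_image
    simp only [this]
    rfl
  · rw [indicatorSum_lmapDomain_of_not_dvd hx, Set.indicator_of_notMem]
    rintro ⟨y, -, rfl⟩
    exact hx (dvd_mul_right p y)

/-- If `Ω_J` is a disjoint union of sets `p_i Ω_{K_i}`, the formal sums add up accordingly. -/
theorem exists_omegaSum_eq_sum [IsLeftCancelMul M]
    (hanti : ∀ p q : M, p ∣ q → q ∣ p → p = q)
    (hlcm : ∀ p q x : M, p ∣ x → q ∣ x → ∃ r, IsRightLCM {p, q} r) {R : Set M} {J : Finset M}
    (hJ : Omega J ∈ finiteDisjointUnions R) :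
    ∃ (n : ℕ) (p : Fin n → M) (K : Fin n → Finset M), (∀ j, (K j : Set M) ⊆ R) ∧
      omegaSum J = ∑ j, Finsupp.lmapDomain ℝ ℝ (p j * ·) (omegaSum (K j)) := by
  obtain ⟨n, p, K, hK, hdisj, hU⟩ := hJ
  refine ⟨n, p, K, hK, linearIndependent_indicator_principalRightIdeal hanti ?_⟩
  change indicatorSum _ = indicatorSum _
  rw [map_sum, indicatorSum_omegaSum hlcm, hU]
  simp only [indicatorSum_lmapDomain_omegaSum hlcm]
  funext x
  rw [Finset.sum_apply]
  by_cases hx : x ∈ ⋃ j, (fun x => p j * x) '' Omega (K j)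
  · obtain ⟨j, hj⟩ := Set.mem_iUnion.1 hx
    rw [Set.indicator_of_mem hx, Finset.sum_eq_single_of_mem j (Finset.mem_univ j),
      Set.indicator_of_mem hj]
    intro i _ hij
    exact Set.indicator_of_notMem (fun hi => Set.disjoint_left.1 (hdisj hij) hi hj) _
  · rw [Set.indicator_of_notMem hx]
    refine (Finset.sum_eq_zero fun j _ => Set.indicator_of_notMem (fun hj => hx ?_) _).symm
    exact Set.mem_iUnion.2 ⟨j, hj⟩

end Combinatorics

/-! ### The positivity condition as a linear functional -/

theorem EReal.coe_finsetSum {ι : Type*} (s : Finset ι) (f : ι → ℝ) :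
    ((∑ i ∈ s, f i : ℝ) : EReal) = ∑ i ∈ s, (f i : EReal) := by
  classical
  induction s using Finset.induction_on with
  | empty => simp
  | insert i s hi ih => rw [Finset.sum_insert hi, Finset.sum_insert hi, EReal.coe_add, ih]

namespace ProductSystem

variable {M : Type u} [Monoid M] {A : Type v} [NonUnitalCStarAlgebra A] [PartialOrder A]
  [StarOrderedRing A] (X : ProductSystem.{u, v, w} M A)

/-- The functional `[p] ↦ N(p)^{-β} Tr_τ^p(a)` on formal sums. -/
noncomputable def traceFunctional (N : M →* ℝ) (β : ℝ) (τ : TracialState A) (a : A) :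
    (M →₀ ℝ) →ₗ[ℝ] ℝ :=
  Finsupp.linearCombination ℝ fun p => N p ^ (-β) * X.fiberTrace τ p a

theorem traceFunctional_single (N : M →* ℝ) (β : ℝ) (τ : TracialState A) (a : A) (p : M)
    (c : ℝ) : X.traceFunctional N β τ a (Finsupp.single p c) =
      c * (N p ^ (-β) * X.fiberTrace τ p a) := by
  rw [traceFunctional, Finsupp.linearCombination_single, smul_eq_mul]

theorem isRightLCM_unique (hanti : ∀ p q : M, p ∣ q → q ∣ p → p = q) {K : Set M} {r s : M}
    (hr : IsRightLCM K r) (hs : IsRightLCM K s) : r = s :=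
  hanti _ _ (hr.2 _ hs.1) (hs.2 _ hr.1)

open Classical in
theorem positivityTerm_eq_coe (hanti : ∀ p q : M, p ∣ q → q ∣ p → p = q) (N : M →* ℝ) (β : ℝ)
    {τ : TracialState A} (hfin : ∀ p ≠ 1, X.HasFiniteTrace τ p) {a : A} (ha : 0 ≤ a)
    {K : Finset M} (hne : K.Nonempty) (h1 : 1 ∉ K) :
    X.positivityTerm N β τ a K = ((X.traceFunctional N β τ a
      (if h : ∃ r : M, IsRightLCM (K : Set M) r then
        Finsupp.single h.choose ((-1) ^ K.card) else 0) : ℝ) : EReal) := by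
  rw [positivityTerm]
  split_ifs with h
  -- A nonempty `K` without `1` has `∨K ≠ 1`, so `fiberTrace` is here the finite induced trace.
  · have hr : h.choose ≠ 1 := by
      intro hr
      obtain ⟨k, hk⟩ := hne
      have hd := h.choose_spec.1 k hk
      rw [hr] at hd
      exact h1 (hanti k 1 hd (one_dvd k) ▸ hk)
    rw [traceFunctional_single, fiberTrace, if_neg hr, ← _root_.mul_assoc, EReal.coe_mul,
      ← EReal.coe_ennreal_toReal (hfin _ hr a ha), EReal.coe_mul, EReal.coe_mul]
  · rw [map_zero, EReal.coe_zero]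

theorem add_sum_positivityTerm_eq (hanti : ∀ p q : M, p ∣ q → q ∣ p → p = q) (N : M →* ℝ)
    (β : ℝ) {τ : TracialState A} (hfin : ∀ p ≠ 1, X.HasFiniteTrace τ p) {a : A} (ha : 0 ≤ a)
    {J : Finset M} (h1 : 1 ∉ J) :
    ((τ.toFun a).re : EReal) +
      ∑ K ∈ J.powerset.filter Finset.Nonempty, X.positivityTerm N β τ a K =
    ((X.traceFunctional N β τ a (omegaSum J) : ℝ) : EReal) := by
  classical
  have hJ : J.powerset = insert ∅ (J.powerset.filter Finset.Nonempty) := by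
    ext K
    rcases K.eq_empty_or_nonempty with rfl | hK
    · simp
    · simp [hK, hK.ne_empty]
  have h0 : ∃ r : M, IsRightLCM ((∅ : Finset M) : Set M) r := ⟨1, by simp [IsRightLCM]⟩
  have hr0 : h0.choose = 1 := isRightLCM_unique hanti h0.choose_spec (by simp [IsRightLCM])
  rw [omegaSum, hJ, Finset.sum_insert (by simp), map_add, map_sum, EReal.coe_add,
    EReal.coe_finsetSum, dif_pos h0, traceFunctional_single, hr0]
  congr 1
  · simp [fiberTrace, TracialState.re_apply]
  · rw [← hJ]
    refine Finset.sum_congr rfl fun K hK => ?_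
    obtain ⟨hK1, hK2⟩ := Finset.mem_filter.1 hK
    exact X.positivityTerm_eq_coe hanti N β hfin ha hK2
      fun h => h1 (Finset.mem_powerset.1 hK1 h)

theorem inducedTrace_le_of_positivityCondition (hanti : ∀ p q : M, p ∣ q → q ∣ p → p = q)
    {N : M →* ℝ} (hN : ∀ p, 0 < N p) {β : ℝ} {τ : TracialState A} {R : Set M}
    (hR : X.PositivityCondition N β τ R) {p : M} (hp : p ∈ R) {a : A} (ha : 0 ≤ a) :
    (X.fiber p).inducedTrace τ a ≤ ENNReal.ofReal (N p ^ β * τ.re a) := by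
  classical
  have h := hR {p} (by simpa using hp) a ha
  have hset : ({p} : Finset M).powerset.filter Finset.Nonempty = {{p}} := by
    ext K
    simp only [Finset.mem_filter, Finset.mem_powerset, Finset.mem_singleton,
      Finset.subset_singleton_iff]
    refine ⟨fun ⟨h1, h2⟩ => h1.resolve_left h2.ne_empty, ?_⟩
    rintro rfl
    exact ⟨Or.inr rfl, Finset.singleton_nonempty p⟩
  have hlcm : ∃ r : M, IsRightLCM (({p} : Finset M) : Set M) r := ⟨p, by simp [IsRightLCM]⟩
  have hch : hlcm.choose = p := isRightLCM_unique hanti hlcm.choose_spec (by simp [IsRightLCM])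
  have hNβ : 0 < N p ^ (-β) := Real.rpow_pos_of_pos (hN p) _
  rw [hset, Finset.sum_singleton, positivityTerm, dif_pos hlcm, hch, Finset.card_singleton,
    pow_one, neg_one_mul] at h
  -- An infinite trace would make the sum `-∞`, contradicting the condition for `{p}`.
  have hfin : (X.fiber p).inducedTrace τ a ≠ ⊤ := by
    intro htop
    rw [htop, EReal.coe_ennreal_top, EReal.coe_mul_top_of_neg (neg_neg_of_pos hNβ),
      EReal.add_bot] at h
    exact absurd h (by simp)
  rw [← EReal.coe_ennreal_toReal hfin, ← EReal.coe_mul, ← EReal.coe_add,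
    EReal.coe_nonneg] at h
  rw [ENNReal.le_ofReal_iff_toReal_le hfin
    (mul_nonneg (Real.rpow_nonneg (hN p).le _) (τ.re_nonneg ha))]
  have h2 : N p ^ (-β) * ((X.fiber p).inducedTrace τ a).toReal ≤ τ.re a := by
    rw [τ.re_apply]; linarith
  rw [Real.rpow_neg (hN p).le, inv_mul_le_iff₀ (Real.rpow_pos_of_pos (hN p) _)] at h2
  exact h2

/-- If `M` is Noetherian and the traces induced through the atoms are bounded by multiples of `τ`,
then so are the traces induced through all `X_p` with `p ≠ 1`. -/
theorem exists_inducedTrace_le (hM : IsNoetherianMonoid M) (hunit : ∀ p : M, IsUnit p → p = 1)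
    {τ : TracialState A}
    (hat : ∀ p ∈ atoms M, ∃ C : ℝ, 0 ≤ C ∧
      ∀ a, 0 ≤ a → (X.fiber p).inducedTrace τ a ≤ ENNReal.ofReal (C * τ.re a))
    (p : M) (hp : p ≠ 1) : ∃ C : ℝ, 0 ≤ C ∧
      ∀ a, 0 ≤ a → (X.fiber p).inducedTrace τ a ≤ ENNReal.ofReal (C * τ.re a) := by
  induction p using WellFounded.induction hM with
  | _ p ih =>
    by_cases hirr : Irreducible p
    · exact hat p hirr
    · rw [irreducible_iff] at hirr
      push Not at hirr
      obtain ⟨x, y, hxy, hx, hy⟩ := hirr fun hu => hp (hunit p hu)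
      have hx1 : x ≠ 1 := by rintro rfl; exact hx isUnit_one
      have hy1 : y ≠ 1 := by rintro rfl; exact hy isUnit_one
      -- Each of `x`, `y` is a proper factor of `p`, since the other one is not a unit.
      obtain ⟨D, hD, hDle⟩ := ih x ⟨1, y, by rw [one_mul, hxy], Or.inr hy⟩ hx1
      obtain ⟨C, hC, hCle⟩ := ih y ⟨x, 1, by rw [mul_one, hxy], Or.inl hx⟩ hy1
      exact ⟨C * D, mul_nonneg hC hD, fun a ha =>
        X.exists_inducedTrace_mul_le hxy.symm hx1 τ hC hDle hCle hD ha⟩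

theorem tendsto_traceFunctional_lmapDomain {N : M →* ℝ} (hN : ∀ p, 0 < N p) (β : ℝ)
    (hunit : ∀ p q : M, p * q = 1 → p = 1) {τ : TracialState A}
    (hfin : ∀ p ≠ 1, X.HasFiniteTrace τ p) {p : M} (hp : p ≠ 1) {I : Type*} {l : Filter I}
    {H : I → Finset (X.fiber p).carrier} (hHs : ∀ i, (X.fiber p).IsSubunital (H i))
    (hH : ∀ η, Tendsto (fun i => (X.fiber p).thetaSum (H i) id η) l (𝓝 η))
    {a : A} (ha : 0 ≤ a) (v : M →₀ ℝ) :
    Tendsto (fun i => ∑ ξ ∈ H i, N p ^ (-β) * X.traceFunctional N β τ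
      ((X.fiber p).inner ξ ((X.fiber p).left a ξ)) v) l
      (𝓝 (X.traceFunctional N β τ a (Finsupp.lmapDomain ℝ ℝ (p * ·) v))) := by
  induction v using Finsupp.induction_linear with
  | zero => simpa using tendsto_const_nhds
  | add v w hv hw =>
    simpa only [map_add, mul_add, Finset.sum_add_distrib] using hv.add hw
  | single q c =>
    have hpq : p * q ≠ 1 := fun h => hp (hunit p q h)
    have h := (X.tendsto_sum_fiberTrace rfl hp hpq (hfin q) (hfin _ hpq) hHs hH ha).const_mul
      (c * N (p * q) ^ (-β))
    rw [Finsupp.lmapDomain_apply, Finsupp.mapDomain_single]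
    simp only [traceFunctional_single]
    rw [← _root_.mul_assoc]
    refine h.congr fun i => ?_
    rw [Finset.mul_sum, map_mul, Real.mul_rpow (hN p).le (hN q).le]
    exact Finset.sum_congr rfl fun ξ _ => by ring

theorem positivityCondition_of_atoms [IsLeftCancelMul M] (hM : IsNoetherianMonoid M)
    (hanti : ∀ p q : M, p ∣ q → q ∣ p → p = q)
    (hlcm : ∀ p q x : M, p ∣ x → q ∣ x → ∃ r, IsRightLCM {p, q} r)
    (hA : MeasureTheory.IsSetAlgebra (finiteDisjointUnions (atoms M)))
    {N : M →* ℝ} (hN : ∀ p, 0 < N p) {β : ℝ} {τ : TracialState A}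
    (h : X.PositivityCondition N β τ (atoms M)) : X.PositivityCondition N β τ {1}ᶜ := by
  classical
  have hunit : ∀ p q : M, p * q = 1 → p = 1 := fun p q hpq =>
    hanti p 1 ⟨q, hpq.symm⟩ (one_dvd p)
  have hfin : ∀ p ≠ 1, X.HasFiniteTrace τ p := by
    intro p hp a ha
    obtain ⟨C, -, hC⟩ := X.exists_inducedTrace_le hM
      (fun p ⟨u, hu⟩ => hunit p _ (hu ▸ u.mul_inv))
      (fun p hp => ⟨N p ^ β, Real.rpow_nonneg (hN p).le _, fun a ha =>
        X.inducedTrace_le_of_positivityCondition hanti hN h hp ha⟩) p hp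
    exact ne_top_of_le_ne_top ENNReal.ofReal_ne_top (hC a ha)
  have hpos : ∀ (K : Finset M), (K : Set M) ⊆ atoms M → ∀ a : A, 0 ≤ a →
      0 ≤ X.traceFunctional N β τ a (omegaSum K) := by
    intro K hK a ha
    have h1 : (1 : M) ∉ K := fun h1 => (hK h1 : Irreducible (1 : M)).not_isUnit isUnit_one
    have := h K hK a ha
    rwa [X.add_sum_positivityTerm_eq hanti N β hfin ha h1, EReal.coe_nonneg] at this
  intro J hJ a ha
  rw [X.add_sum_positivityTerm_eq hanti N β hfin ha fun h1 => hJ h1 rfl, EReal.coe_nonneg]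
  obtain ⟨n, p, K, hK, hsum⟩ :=
    exists_omegaSum_eq_sum hanti hlcm (omega_mem_of_isSetAlgebra hA J)
  rw [hsum, map_sum]
  refine Finset.sum_nonneg fun j _ => ?_
  -- The limit formula needs `p j ≠ 1`; for `p j = 1` the summand is the hypothesis for `K j`.
  rcases eq_or_ne (p j) 1 with hj | hj
  · have hid : Finsupp.lmapDomain ℝ ℝ (p j * ·) (omegaSum (K j)) = omegaSum (K j) := by
      simp only [hj, one_mul, Finsupp.lmapDomain_apply]
      exact Finsupp.mapDomain_id
    rw [hid]
    exact hpos _ (hK j) a ha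
  · obtain ⟨H, hHs, hH⟩ := (X.fiber (p j)).exists_approxUnit
    exact ge_of_tendsto' (X.tendsto_traceFunctional_lmapDomain hN β hunit hfin hj hHs hH ha _)
      fun i => Finset.sum_nonneg fun ξ _ => mul_nonneg (Real.rpow_nonneg (hN _).le _)
        (hpos _ (hK j) _ ((X.fiber (p j)).inner_left_nonneg ha ξ))

end ProductSystem

theorem mainTheorem8 {G : Type u} [Group G] (P : Submonoid G)
    (hP : IsWeakQuasiLatticeOrdered P)
    (hA : MeasureTheory.IsSetAlgebra (finiteDisjointUnions (atoms P))) :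
    finiteDisjointUnions (atoms P) = idealAlgebra P ∧
    (IsNoetherianMonoid P →
      ∀ (A : Type v) [NonUnitalCStarAlgebra A] [PartialOrder A] [StarOrderedRing A]
        (X : ProductSystem.{u, v, w} P A), X.IsEssential → X.IsCompactlyAligned →
      ∀ N : P →* ℝ, (∀ p, 0 < N p) → ∀ (β : ℝ) (τ : TracialState A),
        (X.PositivityCondition N β τ {1}ᶜ ↔ X.PositivityCondition N β τ (atoms P))) := by
  have : IsLeftCancelMul P := ⟨fun p q r h => Subtype.ext (mul_left_cancel
    (congrArg Subtype.val h : (p : G) * q = p * r))⟩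
  have hunit : ∀ x y : P, x * y = 1 → x = 1 := fun x y hxy => by
    have hG : (x : G) * y = 1 := congrArg Subtype.val hxy
    exact Subtype.ext (hP.eq_one_of_inv_mem x x.2 ((inv_eq_of_mul_eq_one_right hG).symm ▸ y.2))
  have hanti : ∀ p q : P, p ∣ q → q ∣ p → p = q := by
    rintro p _ ⟨x, rfl⟩ ⟨y, hy⟩
    have : x * y = 1 := mul_left_cancel (a := p) (by rw [← mul_assoc, ← hy, mul_one])
    rw [hunit x y this, mul_one]
  have hlcm : ∀ p q x : P, p ∣ x → q ∣ x → ∃ r, IsRightLCM {p, q} r := by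
    intro p q x hp hq
    obtain ⟨r, hr⟩ := hP.exists_lcm p q ⟨x, hp, hq⟩
    have hrr : r ∈ {x : P | p ∣ x} ∩ {x : P | q ∣ x} := hr ▸ dvd_refl r
    refine ⟨r, ?_, fun r' hr' => ?_⟩
    · rintro _ (rfl | rfl)
      exacts [hrr.1, hrr.2]
    · have hmem : r' ∈ {x : P | p ∣ x} ∩ {x : P | q ∣ x} := ⟨hr' p (by simp), hr' q (by simp)⟩
      rwa [hr] at hmem
  refine ⟨finiteDisjointUnions_eq_idealAlgebra hA, fun hM A _ _ _ X _ _ N hN β τ => ?_⟩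
  refine ⟨fun h J hJ => h J fun p hp hp1 => ?_, fun h =>
    X.positivityCondition_of_atoms hM hanti hlcm hA hN h⟩
  exact (hJ hp : Irreducible p).not_isUnit (by rw [Set.mem_singleton_iff.1 hp1]; exact isUnit_one)
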